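/- Let $d\ge 2$, let $|\cdot|$ be the Euclidean norm and $\mathcal L$ the Lebesgue measure on $\mathbb R^d$, and let $\Xi$ be the (random) set of points of a Poisson process in $\mathbb R^d$ with unit intensity; its elements are called centers, the elements of $\mathbb R^d$ are called sites. For an appetite $\alpha\in[0,\infty]$, an allocation of $\mathbb R^d$ to $\Xi$ is a measurable function $\psi:\mathbb R^d\to\Xi\cup\{\infty,\Delta\}$ with $\mathcal L(\psi^{-1}(\Delta))=0$ and $\mathcal L(\psi^{-1}(\xi))\le\alpha$ for all $\xi\in\Xi$; the center $\xi$ is sated if $\mathcal L(\psi^{-1}(\xi))=\alpha$ and unsated otherwise, and a site $x$ is unclaimed if $\psi(x)=\infty$. For a center $\xi$ and a site $x$ with $\psi(x)\notin\{\xi,\Delta\}$, we say that $x$ desires $\xi$ if $x$ is unclaimed or $|x-\xi|<|x-\psi(x)|$, and that $\xi$ covets $x$ if $\xi$ is unsated or $|x-\xi|<|x'-\xi|$ for some $x'\in\psi^{-1}(\xi)$. The allocation is stable if there is no pair $(x,\xi)$ such that $x$ desires $\xi$ and $\xi$ covets $x$. Let $\mathcal C$, the set of claimed sites, be the closure of $\psi^{-1}(\Xi)$,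 where $\psi$ is a stable allocation of $\mathbb R^d$ to $\Xi$ with appetite $\alpha$, and let $$\alpha_p(d)=\sup\{\alpha\in[0,\infty]:\ \mathbf P[0\text{ belongs to an unbounded connected subset of }\mathcal C\text{ for appetite }\alpha]=0\}.$$ **Theorem.** Let $d\ge2$. (i) $\alpha_p(d)>0$; moreover, there is $\alpha_0=\alpha_0(d)>0$ such that for every $\alpha\le\alpha_0$, almost surely, $\mathcal C$ has no unbounded connected subset, for any stable allocation with appetite $\alpha$. (ii) There is $\alpha_0=\alpha_0(d)>0$ such that for every $\alpha\le\alpha_0$, almost surely, $\mathbb R^d\setminus\mathcal C$ has an unbounded connected component, for any stable allocation with appetite $\alpha$. -/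

import Mathlib

open MeasureTheory ProbabilityTheory
open scoped ENNReal NNReal

universe u

noncomputable section

/-- The space of sites: `ℝ^d` with the Euclidean norm. -/
abbrev Site (d : ℕ) : Type := EuclideanSpace ℝ (Fin d)

/-- The number of points of `S` in `B`, with value `⊤` if there are infinitely many. -/
def pointCount {d : ℕ} (S B : Set (Site d)) : ℕ∞ := (S ∩ B).encard

/-- `Ξ` is (the random set of points of) a homogeneous Poisson point process on `ℝ^d` with
intensity `lam`: the number of points in a Borel set of finite volume has the Poisson law whose
mean is `lam` times the volume, and the numbers of points in finitely many pairwise disjoint Borel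
sets are independent. -/
structure IsPoissonProcess {d : ℕ} {Ω : Type u} [MeasurableSpace Ω] (P : Measure Ω)
    (Ξ : Ω → Set (Site d)) (lam : ℝ≥0) : Prop where
  hasLaw_count : ∀ B : Set (Site d), MeasurableSet B → volume B < ∞ →
    HasLaw (fun ω => pointCount (Ξ ω) B)
      ((poissonMeasure (lam * (volume B).toNNReal)).map (fun n : ℕ => (n : ℕ∞))) P
  indep_count : ∀ (n : ℕ) (B : Fin n → Set (Site d)), (∀ i, MeasurableSet (B i)) →
    Pairwise (fun i j => Disjoint (B i) (B j)) →
    iIndepFun (fun i ω => pointCount (Ξ ω) (B i)) P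

/-- The possible values of an allocation at a site: a center, `∞` or `Δ`. -/
inductive Assignment (d : ℕ) : Type
  | center (ξ : Site d) : Assignment d
  | unclaimed : Assignment d
  | undecided : Assignment d

/-- The territory of the center `ξ`. -/
def territory {d : ℕ} (ψ : Site d → Assignment d) (ξ : Site d) : Set (Site d) :=
  {x | ψ x = Assignment.center ξ}

/-- `ψ` is an allocation of `ℝ^d` to the set of centers `S` with appetite `α`.  Measurability is
Lebesgue measurability (for a countable set `S` of centers it is enough to look at the preimages
of single values). -/
structure IsAllocation {d : ℕ} (S : Set (Site d)) (α : ℝ≥0∞) (ψ : Site d → Assignment d) :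
    Prop where
  mem_of_eq_center : ∀ x ξ, ψ x = Assignment.center ξ → ξ ∈ S
  measurable_territory : ∀ ξ ∈ S, NullMeasurableSet (territory ψ ξ) volume
  measurable_unclaimed : NullMeasurableSet {x | ψ x = Assignment.unclaimed} volume
  volume_undecided : volume {x | ψ x = Assignment.undecided} = 0
  volume_territory_le : ∀ ξ ∈ S, volume (territory ψ ξ) ≤ α

/-- The site `x` desires the center `ξ`: `x` is unclaimed, or `x` is allocated to a center that is
strictly farther from `x` than `ξ` is (so that, in particular, `x` is not allocated to `ξ`). -/
def Desires {d : ℕ} (ψ : Site d → Assignment d) (x ξ : Site d) : Prop :=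
  ψ x = Assignment.unclaimed ∨ ∃ η, ψ x = Assignment.center η ∧ dist x ξ < dist x η

/-- The center `ξ` covets the site `x`: some site in the territory of `ξ` is strictly farther from
`ξ` than `x` is, or `ξ` is unsated. -/
def Covets {d : ℕ} (α : ℝ≥0∞) (ψ : Site d → Assignment d) (ξ x : Site d) : Prop :=
  (∃ y ∈ territory ψ ξ, dist x ξ < dist y ξ) ∨ volume (territory ψ ξ) ≠ α

/-- `ψ` is a stable allocation to `S` with appetite `α`: there are no unstable pairs. -/
structure IsStableAllocation {d : ℕ} (S : Set (Site d)) (α : ℝ≥0∞)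
    (ψ : Site d → Assignment d) : Prop extends IsAllocation S α ψ where
  stable : ∀ x, ∀ ξ ∈ S, ¬ (Desires ψ x ξ ∧ Covets α ψ ξ x)

/-- The set of claimed sites: the closure of the union of all territories. -/
def claimedSites {d : ℕ} (ψ : Site d → Assignment d) : Set (Site d) :=
  closure {x | ∃ ξ, ψ x = Assignment.center ξ}

/-- There is percolation by claimed sites: some connected subset of the set of claimed sites is
unbounded. -/
def ClaimedPercolation {d : ℕ} (ψ : Site d → Assignment d) : Prop :=
  ∃ A ⊆ claimedSites ψ, IsConnected A ∧ ¬ Bornology.IsBounded A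

/-- The origin belongs to an unbounded connected subset of the set of claimed sites. -/
def OriginPercolates {d : ℕ} (ψ : Site d → Assignment d) : Prop :=
  ∃ A ⊆ claimedSites ψ, (0 : Site d) ∈ A ∧ IsConnected A ∧ ¬ Bornology.IsBounded A

/-- There is percolation by unclaimed sites: the complement of the set of claimed sites has an
unbounded connected component. -/
def UnclaimedPercolation {d : ℕ} (ψ : Site d → Assignment d) : Prop :=
  ∃ x ∈ (claimedSites ψ)ᶜ, ¬ Bornology.IsBounded (connectedComponentIn (claimedSites ψ)ᶜ x)

/-- The percolation threshold `α_p(d)`: the supremum of all appetites `α ∈ [0, ∞]` such that, for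
centers given by a Poisson process of unit intensity, the probability that the origin belongs to
an unbounded connected subset of the set of claimed sites (of a stable allocation with appetite
`α`) is zero. -/
def percolationThreshold (d : ℕ) : ℝ≥0∞ :=
  sSup {α : ℝ≥0∞ | ∀ (Ω : Type) [MeasurableSpace Ω] (P : Measure Ω) [IsProbabilityMeasure P]
    (Ξ : Ω → Set (Site d)), IsPoissonProcess P Ξ 1 →
      P {ω | ∃ ψ, IsStableAllocation (Ξ ω) α ψ ∧ OriginPercolates ψ} = 0}

end

/-!
The cells of a grid of cubes of small side `ε` contain independent Poisson numbers of centers.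

*Localization.* Suppose that a stable allocation gives a site `y` to a center `ξ` at distance `R`.
Then `ξ` covets every site of the ball of radius `R`, so that by stability these sites belong to
centers in the ball of radius `2 * R`, which therefore contains at least `R ^ d / α` centers, up to
a constant (`volume_ball_le_of_mem_territory`). For small `α` this is a large deviation at all
scales above `ε`, while below this scale centers are rare. Hence cells that meet the set of claimed
sites are *bad*, that is, close to a box of cells that contains unusually many centers for its size
(`cell_mem_badCells`), and the probability that a given box is of this kind is as small as desired
and decays with the scale as fast as needed (`exists_forall_measureReal_dense_le`).

*Renormalization.* A path of bad cells that crosses an annulus of scale `22 * L` either uses a dense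
box of scale larger than `L`, or crosses two annuli of scale `L` that are so far apart that the
crossings are independent (`Crossing.step`). The crossing probabilities thus satisfy
`p (22 * L) ≤ K * p L ^ 2 + error` and decay quadratically once the first is small
(`measureReal_crossing_le`, `measure_reach_le`). In particular all clusters of bad cells are
bounded, and as a connected set of sites visits a connected set of cells
(`reach_cell_of_isPreconnected`), this excludes percolation by claimed sites.

*Duality.* If the good cells of a coordinate plane had only finite components, then bad cells would
surround the segment from `(0, 0)` to `(N, 0)` for every `N` (`exists_reach_compl`, from the
connectedness of outer boundaries `reach_boundary`). The surrounding path passes through a point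
`(-a, 0)` and gets farther than `a + N` away from it. By quadratic decay and the Borel–Cantelli
lemma this happens for no `a` if `N` is large (`unclaimedPercolation_of_reach`).
-/

namespace StablePercolation

/-! ### Paths inside a set -/

/-- `v` can be reached from `u` by a path of `adj`-steps all of whose vertices, both ends included,
lie in `S`. -/
def Reach {V : Type*} (adj : V → V → Prop) (S : Set V) (u v : V) : Prop :=
  u ∈ S ∧ Relation.ReflTransGen (fun a b => adj a b ∧ b ∈ S) u v

section Reach

variable {V W : Type*} {adj : V → V → Prop} {S T : Set V} {u v w : V}

lemma Reach.refl (h : u ∈ S) : Reach adj S u u := ⟨h, .refl⟩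

lemma Reach.mem_right (h : Reach adj S u v) : v ∈ S := by
  obtain ⟨hu, h⟩ := h
  induction h with
  | refl => exact hu
  | tail _ h _ => exact h.2

lemma Reach.trans (h : Reach adj S u v) (h' : Reach adj S v w) : Reach adj S u w :=
  ⟨h.1, h.2.trans h'.2⟩

lemma Reach.tail (h : Reach adj S u v) (hvw : adj v w) (hw : w ∈ S) : Reach adj S u w :=
  ⟨h.1, h.2.tail ⟨hvw, hw⟩⟩

lemma Reach.single (hu : u ∈ S) (huv : adj u v) (hv : v ∈ S) : Reach adj S u v :=
  (Reach.refl hu).tail huv hv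

lemma Reach.mono (hST : S ⊆ T) (h : Reach adj S u v) : Reach adj T u v :=
  ⟨hST h.1, h.2.lift id fun _ _ hab => ⟨hab.1, hST hab.2⟩⟩

lemma Reach.symm (hadj : ∀ a b, adj a b → adj b a) (h : Reach adj S u v) : Reach adj S v u := by
  obtain ⟨hu, h⟩ := h
  suffices Reach adj S v u ∧ v ∈ S from this.1
  induction h with
  | refl => exact ⟨.refl hu, hu⟩
  | tail _ hab ih => exact ⟨(Reach.single hab.2 (hadj _ _ hab.1) ih.2).trans ih.1, hab.2⟩

lemma Reach.map {adj' : W → W → Prop} {T : Set W} (f : V → W)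
    (hadj : ∀ a b, adj a b → adj' (f a) (f b)) (hST : ∀ a ∈ S, f a ∈ T)
    (h : Reach adj S u v) : Reach adj' T (f u) (f v) :=
  ⟨hST _ h.1, h.2.lift f fun _ _ hab => ⟨hadj _ _ hab.1, hST _ hab.2⟩⟩

/-- A function that does not change along the steps of a path takes the same value at its ends. -/
lemma Reach.apply_eq {β : Type*} (g : V → β) (hg : ∀ a ∈ S, ∀ b ∈ S, adj a b → g a = g b)
    (h : Reach adj S u v) : g u = g v := by
  obtain ⟨hu, h⟩ := h
  suffices g u = g v ∧ v ∈ S from this.1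
  induction h with
  | refl => exact ⟨rfl, hu⟩
  | tail _ hab ih => exact ⟨ih.1.trans (hg _ ih.2 _ hab.2 hab.1), hab.2⟩

/-- A path that leaves `B` has a first vertex outside `B`; up to there it stays in any set `B'` that
contains `B` and all neighbours of `B`. -/
lemma Reach.exists_first_exit {B B' : Set V} (hBB' : B ⊆ B')
    (hB : ∀ a ∈ B, ∀ b, adj a b → b ∈ B') (h : Reach adj S u v) (hu : u ∈ B) (hv : v ∉ B) :
    ∃ w ∉ B, Reach adj (S ∩ B') u w ∧ Reach adj S w v := by
  obtain ⟨huS, h⟩ := h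
  suffices (v ∈ B ∧ Reach adj (S ∩ B') u v) ∨
      ∃ w ∉ B, Reach adj (S ∩ B') u w ∧ Reach adj S w v from
    this.resolve_left fun h => hv h.1
  clear hv
  induction h with
  | refl => exact .inl ⟨hu, .refl ⟨huS, hBB' hu⟩⟩
  | @tail b c _ hbc ih =>
    rcases ih with ⟨hb, hr⟩ | ⟨w, hw, h1, h2⟩
    · have hr' : Reach adj (S ∩ B') u c := hr.tail hbc.1 ⟨hbc.2, hB _ hb _ hbc.1⟩
      by_cases hc : c ∈ B
      · exact .inl ⟨hc, hr'⟩
      · exact .inr ⟨c, hc, hr', .refl hbc.2⟩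
    · exact .inr ⟨w, hw, h1, h2.tail hbc.1 hbc.2⟩

end Reach

/-! ### Boxes of the lattice and bad cells -/

variable {d : ℕ}

/-- The cube of side `2 * r + 1` centered at `x` in the lattice `ℤ^d`. -/
noncomputable def box (x : Fin d → ℤ) (r : ℕ) : Finset (Fin d → ℤ) :=
  Finset.Icc (fun i => x i - r) (fun i => x i + r)

lemma mem_box {x y : Fin d → ℤ} {r : ℕ} :
    y ∈ box x r ↔ ∀ i, x i - r ≤ y i ∧ y i ≤ x i + r := by
  simp [box, Pi.le_def, forall_and]

lemma box_trans {x y z : Fin d → ℤ} {r s t : ℕ} (hy : y ∈ box x r) (hz : z ∈ box y s)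
    (h : r + s ≤ t) : z ∈ box x t := by
  rw [mem_box] at *
  intro i
  have := hy i
  have := hz i
  omega

lemma mem_box_comm {x y : Fin d → ℤ} {r : ℕ} : y ∈ box x r ↔ x ∈ box y r := by
  simp only [mem_box]
  exact forall_congr' fun i => by omega

lemma mem_box_self (x : Fin d → ℤ) (r : ℕ) : x ∈ box x r := by
  simp [mem_box]

lemma card_box (x : Fin d → ℤ) (r : ℕ) : (box x r).card = (2 * r + 1) ^ d := by
  rw [box, Pi.card_Icc]
  have (i : Fin d) : (Finset.Icc (x i - (r : ℤ)) (x i + r)).card = 2 * r + 1 := by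
    rw [Int.card_Icc]; omega
  simp [this]

/-- Two cells of the lattice are near if each coordinate differs by at most one, that is, if the
corresponding closed cubes touch. -/
def Near (u v : Fin d → ℤ) : Prop := v ∈ box u 1

lemma Near.symm {u v : Fin d → ℤ} (h : Near u v) : Near v u := mem_box_comm.1 h

/-- The box of radius `3 * k` about `z` contains at least `m k` points of the configuration `X` of
cell counts. -/
def Dense (m : ℕ → ℕ) (X : (Fin d → ℤ) → ℕ∞) (z : Fin d → ℤ) (k : ℕ) : Prop :=
  (m k : ℕ∞) ≤ ∑ w ∈ box z (3 * k), X w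

/-- The cells within distance `3 * k` of the center of a dense box of a scale `k` that belongs
to `K`. -/
def badCells (m : ℕ → ℕ) (X : (Fin d → ℤ) → ℕ∞) (K : Set ℕ) : Set (Fin d → ℤ) :=
  {w | ∃ k ∈ K, 1 ≤ k ∧ ∃ z ∈ box w (3 * k), Dense m X z k}

/-- The cells that are bad by virtue of dense boxes of scale at most `L` contain a path from the box
of radius `L` about `x` to the outside of the box of radius `3 * L`. -/
def Crossing (m : ℕ → ℕ) (X : (Fin d → ℤ) → ℕ∞) (x : Fin d → ℤ) (L : ℕ) : Prop :=
  ∃ u ∈ box x L, ∃ v ∉ box x (3 * L), Reach Near (badCells m X (Set.Iic L)) u v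

variable {m : ℕ → ℕ} {X Y : (Fin d → ℤ) → ℕ∞}

lemma Dense.congr {z : Fin d → ℤ} {k : ℕ} (h : ∀ w ∈ box z (3 * k), X w = Y w)
    (hX : Dense m X z k) : Dense m Y z k := by
  rwa [Dense, Finset.sum_congr rfl fun w hw => (h w hw).symm]

lemma Reach.exists_first_exit_box {S : Set (Fin d → ℤ)} {u v x : Fin d → ℤ} {r : ℕ}
    (h : Reach Near S u v) (hu : u ∈ box x r) (hv : v ∉ box x r) :
    ∃ w ∉ box x r, Reach Near (S ∩ box x (r + 1)) u w ∧ Reach Near S w v := by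
  have := Reach.exists_first_exit (adj := Near) (B := box x r) (B' := box x (r + 1))
    (fun a ha => box_trans ha (mem_box_self a 0) (by omega))
    (fun a ha b hab => box_trans ha hab le_rfl) h hu hv
  simpa only [Finset.mem_coe] using this

/-- Crossings of `box x (3 * L)` depend only on the configuration in the box of radius `10 * L`. -/
lemma Crossing.congr {x : Fin d → ℤ} {L : ℕ} (hL : 1 ≤ L) (h : ∀ w ∈ box x (10 * L), X w = Y w)
    (hX : Crossing m X x L) : Crossing m Y x L := by
  obtain ⟨u, hu, v, hv, hr⟩ := hX
  obtain ⟨w, hw, hr, -⟩ := hr.exists_first_exit_box (box_trans hu (mem_box_self u 0) (by omega)) hv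
  refine ⟨u, hu, w, hw, hr.mono ?_⟩
  rintro a ⟨⟨k, hk, hk1, z, hz, hd⟩, ha⟩
  simp only [Set.mem_Iic] at hk
  exact ⟨k, hk, hk1, z, hz, hd.congr fun b hb =>
    h b (box_trans (box_trans ha hz le_rfl) hb (by omega))⟩

/-- The renormalization step. A crossing at scale `22 * L` either uses a dense box of scale larger
than `L`, or produces crossings at scale `L` at two places, the one near its start and the other
near its first exit from the box of radius `44 * L`, which are so far apart that they depend on the
configuration in disjoint boxes. -/
lemma Crossing.step {x : Fin d → ℤ} {L : ℕ} (hL : 1 ≤ L) (hX : Crossing m X x (22 * L)) :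
    (∃ z ∈ box x (154 * L), ∃ k ∈ Finset.Ioc L (22 * L), Dense m X z k) ∨
    ∃ h₁ ∈ box (0 : Fin d → ℤ) 45, ∃ h₂ ∈ box (0 : Fin d → ℤ) 45,
      Disjoint (box (fun i => x i + L * h₁ i) (10 * L)) (box (fun i => x i + L * h₂ i) (10 * L)) ∧
      Crossing m X (fun i => x i + L * h₁ i) L ∧ Crossing m X (fun i => x i + L * h₂ i) L := by
  obtain ⟨u, hu, v, hv, hr⟩ := hX
  obtain ⟨v, hv, hr, -⟩ := hr.exists_first_exit_box (box_trans hu (mem_box_self u 0) (by omega)) hv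
  refine or_iff_not_imp_left.2 fun hD => ?_
  push Not at hD
  -- without dense boxes of large scale, the path is bad at scale `L`
  replace hr : Reach Near (badCells m X (Set.Iic L)) u v := by
    refine hr.mono ?_
    rintro a ⟨⟨k, hk, hk1, z, hz, hd⟩, ha⟩
    simp only [Set.mem_Iic] at hk
    refine ⟨k, ?_, hk1, z, hz, hd⟩
    by_contra hkL
    simp only [Set.mem_Iic, not_le] at hkL
    exact hD z (box_trans ha hz (by omega)) k (by simp; omega) hd
  -- a vertex of the sublattice `x + L ℤ^d` within distance `L`
  have grid : ∀ (y : Fin d → ℤ), y ∈ box x (44 * L + 1) →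
      ∃ h ∈ box (0 : Fin d → ℤ) 45, y ∈ box (fun i => x i + L * h i) L := by
    intro y hy
    have hL0 : (0 : ℤ) < L := by exact_mod_cast hL
    have key : ∀ i, (L : ℤ) * ((y i - x i) / L) ≤ y i - x i ∧
        y i - x i < L * ((y i - x i) / L) + L := fun i =>
      ⟨Int.mul_ediv_self_le hL0.ne', by
        have := Int.lt_mul_ediv_self_add (x := y i - x i) hL0
        linarith⟩
    refine ⟨fun i => (y i - x i) / L, ?_, ?_⟩
    · rw [mem_box] at hy ⊢
      intro i
      have h1 := hy i
      have h2 := key i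
      push_cast at h1
      constructor
      · simp only [Pi.zero_apply, Nat.cast_ofNat]
        by_contra hc
        nlinarith
      · simp only [Pi.zero_apply, Nat.cast_ofNat]
        by_contra hc
        nlinarith
    · rw [mem_box]
      intro i
      have := key i
      constructor <;> linarith
  have huL : u ∈ box x (44 * L) := box_trans hu (mem_box_self u 0) (by omega)
  have hvL : v ∉ box x (44 * L) := fun h => hv (box_trans h (mem_box_self v 0) (by omega))
  obtain ⟨y, hy, hry, hryv⟩ := hr.exists_first_exit_box huL hvL
  have hyB : y ∈ box x (44 * L + 1) := hry.mem_right.2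
  obtain ⟨h₁, hh₁, hu₁⟩ := grid u (box_trans huL (mem_box_self u 0) (by omega))
  obtain ⟨h₂, hh₂, hy₂⟩ := grid y hyB
  refine ⟨h₁, hh₁, h₂, hh₂, ?_, ⟨u, hu₁, v, fun h => hv ?_, hr⟩, ⟨y, hy₂, v, fun h => hv ?_, hryv⟩⟩
  · rw [Finset.disjoint_left]
    intro a ha₁ ha₂
    refine hy ?_
    rw [mem_box] at *
    intro i
    have := hu i
    have := hu₁ i
    have := hy₂ i
    have := ha₁ i
    have := ha₂ i
    push_cast at *
    constructor <;> linarith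
  · exact box_trans (box_trans hu (mem_box_comm.1 hu₁) le_rfl) h (by omega)
  · exact box_trans (box_trans hyB (mem_box_comm.1 hy₂) le_rfl) h (by omega)

end StablePercolation

namespace StablePercolation

/-! ### Decay of the crossing probabilities -/

variable {d : ℕ} {Ω : Type u} [MeasurableSpace Ω] {P : Measure Ω}

/-- Events that depend on the counts in disjoint finite sets of cells are independent. -/
lemma measureReal_and_eq_mul {ι : Type*} {X : ι → Ω → ℕ∞} (hm : ∀ i, AEMeasurable (X i) P)
    (hi : iIndepFun X P) {S T : Finset ι} (hST : Disjoint S T) {A B : (ι → ℕ∞) → Prop}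
    (hA : ∀ x y : ι → ℕ∞, (∀ i ∈ S, x i = y i) → A x → A y)
    (hB : ∀ x y : ι → ℕ∞, (∀ i ∈ T, x i = y i) → B x → B y) :
    P.real {ω | A (fun i => X i ω) ∧ B (fun i => X i ω)} =
      P.real {ω | A (fun i => X i ω)} * P.real {ω | B (fun i => X i ω)} := by
  classical
  have key : ∀ (S : Finset ι) (A : (ι → ℕ∞) → Prop),
      (∀ x y : ι → ℕ∞, (∀ i ∈ S, x i = y i) → A x → A y) →
      ∃ SA : Set (S → ℕ∞), {ω | A (fun i => X i ω)} = (fun ω (i : S) => X i ω) ⁻¹' SA := by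
    intro S A hA
    refine ⟨{r | A fun i => if h : i ∈ S then r ⟨i, h⟩ else 0}, ?_⟩
    ext ω
    simp only [Set.mem_ofPred_eq, Set.mem_preimage]
    constructor
    · exact hA _ _ fun i hi => by simp [hi]
    · exact hA _ _ fun i hi => by simp [hi]
  obtain ⟨SA, hSA⟩ := key S A hA
  obtain ⟨SB, hSB⟩ := key T B hB
  have h := (hi.indepFun_finset₀ S T hST hm).measure_inter_preimage_eq_mul SA SB
    (Set.to_countable _).measurableSet (Set.to_countable _).measurableSet
  rw [show {ω | A (fun i => X i ω) ∧ B (fun i => X i ω)} =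
    {ω | A (fun i => X i ω)} ∩ {ω | B (fun i => X i ω)} from rfl, hSA, hSB, measureReal_def, h,
    ENNReal.toReal_mul]
  rfl

/-- The union bound for an event that is covered by finitely many others. -/
lemma measureReal_exists_le [IsProbabilityMeasure P] {ι : Type*} (S : Finset ι)
    {A : ι → Ω → Prop} {c : ℝ} (h : ∀ i ∈ S, P.real {ω | A i ω} ≤ c) :
    P.real {ω | ∃ i ∈ S, A i ω} ≤ S.card * c := by
  have : {ω | ∃ i ∈ S, A i ω} = ⋃ i ∈ S, {ω | A i ω} := by ext; simp
  rw [this]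
  calc P.real (⋃ i ∈ S, {ω | A i ω}) ≤ ∑ i ∈ S, P.real {ω | A i ω} :=
        measureReal_biUnion_finset_le S _
    _ ≤ ∑ _i ∈ S, c := Finset.sum_le_sum h
    _ = S.card * c := by simp

variable [IsProbabilityMeasure P] {m : ℕ → ℕ} {X : (Fin d → ℤ) → Ω → ℕ∞}

/-- The level below which the crossing probability at scale one has to be for the recursion
`p (22 * L) ≤ 91 ^ (2 * d) * p L ^ 2 + error` to give quadratic decay. -/
noncomputable def crossingLevel (d : ℕ) : ℝ := 1 / (968 * 91 ^ (2 * d))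

/-- The density of dense boxes that keeps the error terms of the recursion below half of what
quadratic decay allows. -/
noncomputable def denseLevel (d : ℕ) : ℝ := crossingLevel d / (330 ^ d * (22 * 968))

lemma crossingLevel_pos (d : ℕ) : 0 < crossingLevel d := by unfold crossingLevel; positivity

lemma denseLevel_pos (d : ℕ) : 0 < denseLevel d := by
  have := crossingLevel_pos d
  unfold denseLevel; positivity

lemma measureReal_crossing_one_le
    (hD : ∀ z k, 1 ≤ k →
      P.real {ω | Dense m (fun w => X w ω) z k} ≤ denseLevel d / (k : ℝ) ^ (d + 4))
    (x : Fin d → ℤ) : P.real {ω | Crossing m (fun w => X w ω) x 1} ≤ crossingLevel d := by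
  have hsub : {ω | Crossing m (fun w => X w ω) x 1} ⊆
      {ω | ∃ z ∈ box x 4, Dense m (fun w => X w ω) z 1} := by
    rintro ω ⟨u, hu, v, hv, ⟨k, hk, hk1, z, hz, hd⟩, -⟩
    obtain rfl : k = 1 := le_antisymm hk hk1
    exact ⟨z, box_trans hu hz (by omega), hd⟩
  calc P.real {ω | Crossing m (fun w => X w ω) x 1}
      ≤ P.real {ω | ∃ z ∈ box x 4, Dense m (fun w => X w ω) z 1} := measureReal_mono hsub
    _ ≤ (box x 4).card * denseLevel d :=
        measureReal_exists_le _ fun z _ => by simpa using hD z 1 le_rfl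
    _ = 9 ^ d * denseLevel d := by rw [card_box]; norm_num
    _ ≤ 330 ^ d * (22 * 968) * denseLevel d := by
        have := denseLevel_pos d
        gcongr
        have : (9 : ℝ) ^ d ≤ 330 ^ d := by gcongr; norm_num
        have : (0 : ℝ) < 330 ^ d := by positivity
        linarith
    _ = crossingLevel d := by
        unfold denseLevel; field_simp

lemma measureReal_crossing_step (hm : ∀ w, AEMeasurable (X w) P) (hi : iIndepFun X P)
    (hD : ∀ z k, 1 ≤ k →
      P.real {ω | Dense m (fun w => X w ω) z k} ≤ denseLevel d / (k : ℝ) ^ (d + 4))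
    {L : ℕ} (hL : 1 ≤ L) {p : ℝ} (hp : ∀ x, P.real {ω | Crossing m (fun w => X w ω) x L} ≤ p)
    (x : Fin d → ℤ) :
    P.real {ω | Crossing m (fun w => X w ω) x (22 * L)} ≤
      91 ^ (2 * d) * p ^ 2 + 330 ^ d * 22 * denseLevel d / (L : ℝ) ^ 3 := by
  classical
  have hL0 : (1 : ℝ) ≤ L := by exact_mod_cast hL
  set I : Finset ((Fin d → ℤ) × ℕ) := box x (154 * L) ×ˢ Finset.Ioc L (22 * L) with hI
  set J : Finset ((Fin d → ℤ) × (Fin d → ℤ)) := box 0 45 ×ˢ box 0 45 with hJ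
  set g : (Fin d → ℤ) → Fin d → ℤ := fun h i => x i + L * h i with hg
  have hsub : {ω | Crossing m (fun w => X w ω) x (22 * L)} ⊆
      {ω | ∃ q ∈ J, Disjoint (box (g q.1) (10 * L)) (box (g q.2) (10 * L)) ∧
        Crossing m (fun w => X w ω) (g q.1) L ∧ Crossing m (fun w => X w ω) (g q.2) L} ∪
      {ω | ∃ q ∈ I, Dense m (fun w => X w ω) q.1 q.2} := by
    intro ω hω
    rcases Crossing.step hL hω with ⟨z, hz, k, hk, h⟩ | ⟨h₁, hh₁, h₂, hh₂, h⟩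
    · exact .inr ⟨(z, k), by simp only [hI, Finset.mem_product]; exact ⟨hz, hk⟩, h⟩
    · exact .inl ⟨(h₁, h₂), by simp only [hJ, Finset.mem_product]; exact ⟨hh₁, hh₂⟩, h⟩
  have h1 : P.real {ω | ∃ q ∈ J, Disjoint (box (g q.1) (10 * L)) (box (g q.2) (10 * L)) ∧
        Crossing m (fun w => X w ω) (g q.1) L ∧ Crossing m (fun w => X w ω) (g q.2) L} ≤
      91 ^ (2 * d) * p ^ 2 := by
    refine (measureReal_exists_le J (c := p ^ 2) ?_).trans_eq ?_
    · intro q _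
      by_cases hq : Disjoint (box (g q.1) (10 * L)) (box (g q.2) (10 * L))
      · simp only [hq, true_and]
        rw [measureReal_and_eq_mul hm hi hq (A := fun x => Crossing m x (g q.1) L)
          (B := fun x => Crossing m x (g q.2) L) (fun _ _ h => Crossing.congr hL h)
          (fun _ _ h => Crossing.congr hL h), sq]
        exact mul_le_mul (hp _) (hp _) measureReal_nonneg (measureReal_nonneg.trans (hp x))
      · simp only [hq, false_and]
        simp only [Set.ofPred_false, measureReal_empty]
        positivity
    · rw [hJ, Finset.card_product, card_box, two_mul d, pow_add]
      norm_num
  have h2 : P.real {ω | ∃ q ∈ I, Dense m (fun w => X w ω) q.1 q.2} ≤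
      330 ^ d * 22 * denseLevel d / (L : ℝ) ^ 3 := by
    refine (measureReal_exists_le I (c := denseLevel d / (L : ℝ) ^ (d + 4)) ?_).trans ?_
    · rintro ⟨z, k⟩ hq
      simp only [hI, Finset.mem_product, Finset.mem_Ioc] at hq
      refine (hD z k (by omega)).trans ?_
      have := denseLevel_pos d
      have : (L : ℝ) ≤ k := by exact_mod_cast hq.2.1.le
      gcongr
    · have hcard : (I.card : ℝ) ≤ (330 * L) ^ d * (22 * L) := by
        rw [hI, Finset.card_product, card_box, Nat.card_Ioc]
        push_cast
        have : ((22 * L - L : ℕ) : ℝ) ≤ 22 * L := by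
          exact_mod_cast Nat.sub_le _ _
        gcongr
        linarith
      have := denseLevel_pos d
      calc (I.card : ℝ) * (denseLevel d / (L : ℝ) ^ (d + 4))
          ≤ (330 * L) ^ d * (22 * L) * (denseLevel d / (L : ℝ) ^ (d + 4)) := by gcongr
        _ = 330 ^ d * 22 * denseLevel d / (L : ℝ) ^ 3 := by
          rw [mul_pow, pow_add]; field_simp
  exact (measureReal_mono hsub).trans ((measureReal_union_le _ _).trans (add_le_add h1 h2))

/-- Crossing probabilities decay quadratically along the scales `22 ^ n`. -/
lemma measureReal_crossing_le (hm : ∀ w, AEMeasurable (X w) P) (hi : iIndepFun X P)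
    (hD : ∀ z k, 1 ≤ k →
      P.real {ω | Dense m (fun w => X w ω) z k} ≤ denseLevel d / (k : ℝ) ^ (d + 4))
    (n : ℕ) (x : Fin d → ℤ) :
    P.real {ω | Crossing m (fun w => X w ω) x (22 ^ n)} ≤ crossingLevel d / (22 ^ n) ^ 2 := by
  induction n generalizing x with
  | zero => simpa using measureReal_crossing_one_le hD x
  | succ n ih =>
    have hθ := crossingLevel_pos d
    have hL : (1 : ℝ) ≤ 22 ^ n := one_le_pow₀ (by norm_num)
    have h := measureReal_crossing_step hm hi hD (Nat.one_le_pow n 22 (by norm_num)) ih x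
    rw [pow_succ' 22 n, pow_succ' (22 : ℝ) n]
    refine h.trans ?_
    push_cast
    set L : ℝ := 22 ^ n
    have e1 : (91 : ℝ) ^ (2 * d) * (crossingLevel d / L ^ 2) ^ 2 =
        crossingLevel d / (968 * L ^ 4) := by
      unfold crossingLevel; field_simp
    have e2 : 330 ^ d * 22 * denseLevel d / L ^ 3 = crossingLevel d / (968 * L ^ 3) := by
      unfold denseLevel; field_simp
    have i1 : crossingLevel d / (968 * L ^ 4) ≤ crossingLevel d / (968 * L ^ 2) := by
      gcongr
      norm_num
    have i2 : crossingLevel d / (968 * L ^ 3) ≤ crossingLevel d / (968 * L ^ 2) := by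
      gcongr; norm_num
    have e3 : crossingLevel d / (22 * L) ^ 2 = 2 * (crossingLevel d / (968 * L ^ 2)) := by
      field_simp; norm_num
    rw [e1, e2, e3]
    linarith

/-- The probability that bad cells connect `x` to the outside of the box of radius `3 * 22 ^ n`
about `x`: either there is a crossing at scale `22 ^ n`, or a dense box of a larger scale `k` is
involved, whose center is then within distance `7 * k`. -/
lemma measure_reach_le_of_scale (hm : ∀ w, AEMeasurable (X w) P) (hi : iIndepFun X P)
    (hD : ∀ z k, 1 ≤ k →
      P.real {ω | Dense m (fun w => X w ω) z k} ≤ denseLevel d / (k : ℝ) ^ (d + 4)) :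
    ∃ C : ℝ, 0 ≤ C ∧ ∀ n x, P {ω | ∃ v ∉ box x (3 * 22 ^ n),
      Reach Near (badCells m (fun w => X w ω) Set.univ) x v} ≤
        ENNReal.ofReal (C / (22 ^ n) ^ 2) := by
  have hsum : Summable fun j : ℕ => 1 / ((j : ℝ) + 1) ^ 2 := by
    have := (summable_nat_add_iff 1).2 (Real.summable_one_div_nat_pow.2 one_lt_two)
    simpa using this
  have hδ := denseLevel_pos d
  have hθ := crossingLevel_pos d
  refine ⟨crossingLevel d + 15 ^ d * denseLevel d * ∑' j : ℕ, 1 / ((j : ℝ) + 1) ^ 2,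
    by positivity, fun n x => ?_⟩
  set N : ℕ := 22 ^ n with hN
  have hN1 : 1 ≤ N := Nat.one_le_pow n 22 (by norm_num)
  have hNr : ((22 : ℝ) ^ n) = N := by rw [hN]; push_cast; rfl
  have hNr1 : (1 : ℝ) ≤ N := by exact_mod_cast hN1
  rw [hNr]
  have hsub : {ω | ∃ v ∉ box x (3 * N),
      Reach Near (badCells m (fun w => X w ω) Set.univ) x v} ⊆
      {ω | Crossing m (fun w => X w ω) x N} ∪
        ⋃ j : ℕ, {ω | ∃ z ∈ box x (7 * (N + 1 + j)), Dense m (fun w => X w ω) z (N + 1 + j)} := by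
    rintro ω ⟨v, hv, hr⟩
    obtain ⟨v, hv, hr, -⟩ := hr.exists_first_exit_box (mem_box_self x _) hv
    refine or_iff_not_imp_right.2 fun hD => ⟨x, mem_box_self x _, v, hv, hr.mono ?_⟩
    rintro a ⟨⟨k, -, hk1, z, hz, hd⟩, ha⟩
    refine ⟨k, ?_, hk1, z, hz, hd⟩
    by_contra hkL
    simp only [Set.mem_Iic, not_le] at hkL
    obtain ⟨j, rfl⟩ : ∃ j, k = N + 1 + j := ⟨k - (N + 1), by omega⟩
    exact hD (Set.mem_iUnion.2 ⟨j, z, box_trans ha hz (by omega), hd⟩)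
  have hj : ∀ j : ℕ, P {ω | ∃ z ∈ box x (7 * (N + 1 + j)),
      Dense m (fun w => X w ω) z (N + 1 + j)} ≤
      ENNReal.ofReal (15 ^ d * denseLevel d / (N : ℝ) ^ 2 * (1 / ((j : ℝ) + 1) ^ 2)) := by
    intro j
    rw [← ofReal_measureReal]
    refine ENNReal.ofReal_le_ofReal ?_
    set k : ℕ := N + 1 + j with hk
    have hk1 : (1 : ℝ) ≤ k := by exact_mod_cast (by omega : 1 ≤ k)
    have hkN : (N : ℝ) ≤ k := by exact_mod_cast (by omega : N ≤ k)
    have hkj : (j : ℝ) + 1 ≤ k := by exact_mod_cast (by omega : j + 1 ≤ k)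
    refine (measureReal_exists_le _ fun z _ => hD z k (by omega)).trans ?_
    rw [card_box]
    calc (((2 * (7 * k) + 1) ^ d : ℕ) : ℝ) * (denseLevel d / (k : ℝ) ^ (d + 4))
        ≤ (15 * k) ^ d * (denseLevel d / (k : ℝ) ^ (d + 4)) := by
          push_cast
          gcongr
          linarith
      _ = 15 ^ d * denseLevel d / (k : ℝ) ^ 2 * (1 / (k : ℝ) ^ 2) := by
          rw [mul_pow, pow_add]; field_simp
      _ ≤ _ := by gcongr
  calc P {ω | ∃ v ∉ box x (3 * N), Reach Near (badCells m (fun w => X w ω) Set.univ) x v}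
      ≤ P {ω | Crossing m (fun w => X w ω) x N} + ∑' j : ℕ, P {ω | ∃ z ∈ box x (7 * (N + 1 + j)),
          Dense m (fun w => X w ω) z (N + 1 + j)} :=
        (measure_mono hsub).trans ((measure_union_le _ _).trans (by gcongr; exact measure_iUnion_le _))
    _ ≤ ENNReal.ofReal (crossingLevel d / (N : ℝ) ^ 2) + ∑' j : ℕ,
          ENNReal.ofReal (15 ^ d * denseLevel d / (N : ℝ) ^ 2 * (1 / ((j : ℝ) + 1) ^ 2)) := by
        gcongr with j
        · rw [← ofReal_measureReal, ← hNr]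
          exact ENNReal.ofReal_le_ofReal (measureReal_crossing_le hm hi hD n x)
        · exact hj j
    _ = _ := by
        rw [← ENNReal.ofReal_tsum_of_nonneg (fun j => by positivity) (hsum.mul_left _),
          tsum_mul_left, ← ENNReal.ofReal_add (by positivity) (by positivity)]
        congr 1
        field_simp

/-- The probability that bad cells connect `x` to distance `r` decays quadratically in `r`. -/
theorem measure_reach_le (hm : ∀ w, AEMeasurable (X w) P) (hi : iIndepFun X P)
    (hD : ∀ z k, 1 ≤ k →
      P.real {ω | Dense m (fun w => X w ω) z k} ≤ denseLevel d / (k : ℝ) ^ (d + 4)) :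
    ∃ C : ℝ, ∀ (r : ℕ) (x : Fin d → ℤ), 1 ≤ r → P {ω | ∃ v ∉ box x r,
      Reach Near (badCells m (fun w => X w ω) Set.univ) x v} ≤
        ENNReal.ofReal (C / (r : ℝ) ^ 2) := by
  obtain ⟨C, hC, h⟩ := measure_reach_le_of_scale hm hi hD
  refine ⟨66 ^ 2 * C + 9, fun r x hr => ?_⟩
  have hr0 : (0 : ℝ) < r := by exact_mod_cast hr
  rcases lt_or_ge r 3 with hr3 | hr3
  · refine prob_le_one.trans ?_
    rw [← ENNReal.ofReal_one]
    refine ENNReal.ofReal_le_ofReal ?_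
    rw [le_div_iff₀ (by positivity)]
    have : (r : ℝ) ≤ 3 := by exact_mod_cast hr3.le
    nlinarith
  · -- the largest scale `22 ^ n` with `3 * 22 ^ n ≤ r`
    set n := Nat.log 22 (r / 3)
    have h1 : 22 ^ n ≤ r / 3 := Nat.pow_log_le_self 22 (by omega)
    have h2 : r / 3 < 22 ^ (n + 1) := Nat.lt_pow_succ_log_self (by norm_num) _
    rw [pow_succ] at h2
    refine (measure_mono ?_).trans ((h n x).trans (ENNReal.ofReal_le_ofReal ?_))
    · rintro ω ⟨v, hv, hvr⟩
      exact ⟨v, fun h => hv (box_trans h (mem_box_self v 0) (by omega)), hvr⟩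
    · have h3 : (r : ℝ) ≤ 66 * 22 ^ n := by
        have : r ≤ 66 * 22 ^ n := by omega
        exact_mod_cast this
      rw [div_le_div_iff₀ (by positivity) (by positivity)]
      calc C * (r : ℝ) ^ 2 ≤ C * (66 * 22 ^ n) ^ 2 := by gcongr
        _ = 66 ^ 2 * C * (22 ^ n) ^ 2 := by ring
        _ ≤ _ := by gcongr; linarith

end StablePercolation

namespace StablePercolation

/-! ### Poisson counts in boxes of cells -/

lemma poissonMeasure_real_one_le (r : ℝ≥0) : (poissonMeasure r).real {n | 1 ≤ n} ≤ r := by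
  have h : {n : ℕ | 1 ≤ n} = {0}ᶜ := by ext n; simp [Nat.one_le_iff_ne_zero]
  rw [h, probReal_compl_eq_one_sub (by measurability), poissonMeasure_real_singleton]
  have := Real.add_one_le_exp (-(r : ℝ))
  simp only [pow_zero, mul_one, Nat.factorial_zero, Nat.cast_one, div_one]
  linarith

/-- The Chernoff bound for the Poisson law, from the moment of `2 ^ n`. -/
lemma poissonMeasure_real_ge_le (r : ℝ≥0) (m : ℕ) :
    (poissonMeasure r).real {n | m ≤ n} ≤ Real.exp r / 2 ^ m := by
  have hs : HasSum (fun n : ℕ => Real.exp (-r) * r ^ n / (n.factorial : ℝ) * 2 ^ n)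
      (Real.exp r) := by
    have := (NormedSpace.expSeries_div_hasSum_exp (2 * r : ℝ)).mul_left (Real.exp (-r))
    rw [← Real.exp_eq_exp_ℝ, ← Real.exp_add, show -(r : ℝ) + 2 * r = r by ring] at this
    refine this.congr_fun ?_
    intro n
    rw [mul_pow]; ring
  have hint : Integrable (fun n : ℕ => (2 : ℝ) ^ n) (poissonMeasure r) := by
    rw [integrable_poissonMeasure_iff]
    simpa using hs.summable
  have h := mul_meas_ge_le_integral_of_nonneg (μ := poissonMeasure r)
    (Filter.Eventually.of_forall fun n => by positivity) hint ((2 : ℝ) ^ m)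
  rw [integral_poissonMeasure' hint] at h
  simp only [smul_eq_mul, hs.tsum_eq] at h
  simp only [pow_le_pow_iff_right₀ (one_lt_two (α := ℝ))] at h
  rwa [le_div_iff₀ (by positivity), mul_comm]

variable {d : ℕ}

/-- The cell of side `ε` that contains the site `x`. -/
noncomputable def cell (ε : ℝ) (x : Site d) : Fin d → ℤ := fun i => ⌊x i / ε⌋

/-- The number of centers in a cell. -/
noncomputable def cellCount (ε : ℝ) (S : Set (Site d)) (w : Fin d → ℤ) : ℕ∞ :=
  pointCount S {x | cell ε x = w}

lemma measurableSet_cell_mem (ε : ℝ) (B : Set (Fin d → ℤ)) :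
    MeasurableSet {x : Site d | cell ε x ∈ B} := by
  have : Measurable (cell ε : Site d → Fin d → ℤ) := by
    refine measurable_pi_lambda _ fun i => Int.measurable_floor.comp ?_
    fun_prop
  exact this (Set.to_countable B).measurableSet

lemma sum_cellCount (ε : ℝ) (S : Set (Site d)) (B : Finset (Fin d → ℤ)) :
    ∑ w ∈ B, cellCount ε S w = pointCount S {x | cell ε x ∈ B} := by
  classical
  induction B using Finset.induction_on with
  | empty => simp [pointCount]
  | insert w B hw ih =>
    rw [Finset.sum_insert hw, ih, cellCount, pointCount, pointCount, pointCount,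
      ← Set.encard_union_eq, ← Set.inter_union_distrib_left]
    · congr 2
      ext x
      simp
    · refine Set.disjoint_left.2 fun x hx hx' => hw ?_
      rw [← show cell ε x = w from hx.2]
      exact hx'.2

lemma cell_mem_box_subset {ε : ℝ} (hε : 0 < ε) (z : Fin d → ℤ) (r : ℕ) :
    {x : Site d | cell ε x ∈ box z r} ⊆ (WithLp.ofLp : Site d → Fin d → ℝ) ⁻¹'
      (Set.univ.pi fun i => Set.Ico ((z i - r) * ε) ((z i + r + 1) * ε)) := by
  intro x hx i _
  have hx' := mem_box.1 (show cell ε x ∈ box z r from hx) i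
  have h1 := Int.floor_le (x i / ε)
  have h2 := Int.lt_floor_add_one (x i / ε)
  have h3 : ((z i - r : ℤ) : ℝ) ≤ ⌊x i / ε⌋ := Int.cast_le.2 hx'.1
  have h4 : ((⌊x i / ε⌋ : ℤ) : ℝ) ≤ (z i + r : ℤ) := Int.cast_le.2 hx'.2
  push_cast at h3 h4
  constructor
  · rw [← le_div_iff₀ hε]; linarith
  · rw [← div_lt_iff₀ hε]; linarith

lemma volume_cell_mem_box_le {ε : ℝ} (hε : 0 < ε) (z : Fin d → ℤ) (r : ℕ) :
    volume {x : Site d | cell ε x ∈ box z r} ≤ ENNReal.ofReal (((2 * r + 1) * ε) ^ d) := by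
  refine (measure_mono (cell_mem_box_subset hε z r)).trans_eq ?_
  rw [(PiLp.volume_preserving_ofLp (Fin d)).measure_preimage
    (MeasurableSet.univ_pi fun _ => measurableSet_Ico).nullMeasurableSet, volume_pi_pi]
  simp only [Real.volume_Ico]
  rw [Finset.prod_congr rfl (g := fun _ => ENNReal.ofReal ((2 * r + 1) * ε))
    fun i _ => by congr 1; ring]
  rw [Finset.prod_const, Finset.card_univ, Fintype.card_fin, ENNReal.ofReal_pow (by positivity)]

variable {Ω : Type u} [MeasurableSpace Ω] {P : Measure Ω} {Ξ : Ω → Set (Site d)}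

lemma volume_cell_lt_top {ε : ℝ} (hε : 0 < ε) (w : Fin d → ℤ) :
    volume {x : Site d | cell ε x = w} < ∞ := by
  refine (measure_mono ?_).trans_lt ((volume_cell_mem_box_le hε w 0).trans_lt ENNReal.ofReal_lt_top)
  rintro x rfl
  exact mem_box_self _ _

lemma measurableSet_cell (ε : ℝ) (w : Fin d → ℤ) : MeasurableSet {x : Site d | cell ε x = w} :=
  measurableSet_cell_mem ε {w}

lemma aemeasurable_cellCount (hΞ : IsPoissonProcess P Ξ 1) {ε : ℝ} (hε : 0 < ε)
    (w : Fin d → ℤ) : AEMeasurable (fun ω => cellCount ε (Ξ ω) w) P :=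
  (hΞ.hasLaw_count _ (measurableSet_cell ε w) (volume_cell_lt_top hε w)).aemeasurable

lemma iIndepFun_cellCount (hΞ : IsPoissonProcess P Ξ 1) (ε : ℝ) :
    iIndepFun (fun w ω => cellCount ε (Ξ ω) w) P := by
  rw [iIndepFun_iff_finset]
  intro s
  have h := hΞ.indep_count s.card (fun i => {x | cell ε x = s.equivFin.symm i})
    (fun i => measurableSet_cell ε _) (fun i j hij => by
      refine Set.disjoint_left.2 fun x hx hx' => hij ?_
      have : (s.equivFin.symm i : Fin d → ℤ) = s.equivFin.symm j :=
        (show cell ε x = _ from hx).symm.trans hx'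
      simpa using Subtype.ext this)
  have := h.precomp s.equivFin.injective
  simpa [Finset.restrict_def, cellCount] using this

lemma measureReal_dense_le [IsProbabilityMeasure P] (hΞ : IsPoissonProcess P Ξ 1) {ε : ℝ}
    (hε : 0 < ε) (m : ℕ → ℕ) (z : Fin d → ℤ) (k : ℕ) :
    ∃ μ : ℝ≥0, (μ : ℝ) ≤ ((2 * (3 * k) + 1) * ε) ^ d ∧
      P.real {ω | Dense m (fun w => cellCount ε (Ξ ω) w) z k} ≤
        (poissonMeasure μ).real {n | m k ≤ n} := by
  set B := {x : Site d | cell ε x ∈ box z (3 * k)} with hB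
  have hvol := volume_cell_mem_box_le hε z (3 * k)
  have hlaw := hΞ.hasLaw_count B (measurableSet_cell_mem ε (box z (3 * k) : Set (Fin d → ℤ)))
    (hvol.trans_lt ENNReal.ofReal_lt_top)
  refine ⟨1 * (volume B).toNNReal, ?_, ?_⟩
  · have := ENNReal.toReal_mono ENNReal.ofReal_ne_top hvol
    rw [ENNReal.toReal_ofReal (by positivity)] at this
    rw [one_mul]
    exact_mod_cast this
  · simp only [Dense, sum_cellCount]
    rw [hlaw.measureReal_eq (p := fun n => (m k : ℕ∞) ≤ n) (by measurability),
      map_measureReal_apply (by fun_prop) (by measurability)]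
    refine (congrArg _ ?_).le
    ext n
    simp

/-- The number of centers that makes the box of radius `3 * k` dense: a single one for `k = 1`, and
`M` times the order of its volume for larger `k`. -/
def threshold (d M k : ℕ) : ℕ := if k ≤ 1 then 1 else M * k ^ d

/-- For cells that are small enough, and then `M` large enough, dense boxes are as rare as
desired. -/
lemma exists_forall_measureReal_dense_le (hd : 1 ≤ d) {δ : ℝ} (hδ : 0 < δ) :
    ∃ ε : ℝ, 0 < ε ∧ ∃ M : ℕ, 1 ≤ M ∧ ∀ (Ω : Type u) [MeasurableSpace Ω] (P : Measure Ω)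
      [IsProbabilityMeasure P] (Ξ : Ω → Set (Site d)), IsPoissonProcess P Ξ 1 →
      ∀ z k, 1 ≤ k →
        P.real {ω | Dense (threshold d M) (fun w => cellCount ε (Ξ ω) w) z k} ≤
          δ / (k : ℝ) ^ (d + 4) := by
  obtain ⟨j, hj⟩ := exists_pow_lt_of_lt_one hδ (one_half_lt_one (α := ℝ))
  refine ⟨min 1 δ / 7, by positivity, d + 6 + j, by omega, ?_⟩
  intro Ω _ P _ Ξ hΞ z k hk
  have hk1 : (1 : ℝ) ≤ k := by exact_mod_cast hk
  obtain ⟨μ, hμ, h⟩ := measureReal_dense_le hΞ (ε := min 1 δ / 7) (by positivity)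
    (threshold d (d + 6 + j)) z k
  refine h.trans ?_
  have hc0 : 0 < min 1 δ := by positivity
  have hμ' : (μ : ℝ) ≤ min 1 δ * k ^ d := by
    calc (μ : ℝ) ≤ ((2 * (3 * k) + 1) * (min 1 δ / 7)) ^ d := by exact_mod_cast hμ
      _ ≤ (k * min 1 δ) ^ d := by
        refine pow_le_pow_left₀ (by positivity) ?_ d
        nlinarith
      _ = min 1 δ ^ d * k ^ d := by rw [mul_pow, mul_comm]
      _ ≤ min 1 δ * k ^ d := by
        gcongr
        exact pow_le_of_le_one hc0.le (min_le_left _ _) (by omega)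
  rcases hk.eq_or_lt with rfl | hk2
  · refine (poissonMeasure_real_one_le μ).trans ?_
    simpa using hμ'.trans (by simp)
  · have ht : threshold d (d + 6 + j) k = (d + 6 + j) * k ^ d := if_neg (by omega)
    rw [ht]
    refine (poissonMeasure_real_ge_le μ _).trans ?_
    have he : Real.exp μ ≤ 2 ^ (2 * k ^ d) := by
      calc Real.exp μ ≤ Real.exp ((k ^ d : ℕ) * 1) := by
            refine Real.exp_le_exp.2 (hμ'.trans ?_)
            push_cast
            rw [mul_one]
            exact mul_le_of_le_one_left (by positivity) (min_le_left _ _)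
        _ = Real.exp 1 ^ (k ^ d) := by rw [Real.exp_nat_mul]
        _ ≤ 4 ^ (k ^ d) := by
            gcongr
            have := Real.exp_one_lt_d9
            linarith
        _ = 2 ^ (2 * k ^ d) := by rw [pow_mul]; norm_num
    have hk2 : (k : ℝ) ≤ 2 ^ (k ^ d) := by
      have h1 : k < 2 ^ k := Nat.lt_two_pow_self
      have h2 : 2 ^ k ≤ 2 ^ (k ^ d) :=
        Nat.pow_le_pow_right (by norm_num) (Nat.le_self_pow (by omega) k)
      exact_mod_cast h1.le.trans h2
    have hk3 : (2 : ℝ) ^ j ≤ 2 ^ (j * k ^ d) := by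
      refine pow_le_pow_right₀ one_le_two ?_
      exact Nat.le_mul_of_pos_right _ (by positivity)
    calc Real.exp μ / 2 ^ ((d + 6 + j) * k ^ d)
        ≤ 2 ^ (2 * k ^ d) / 2 ^ ((d + 6 + j) * k ^ d) := by gcongr
      _ = 1 / (2 ^ (j * k ^ d)) / (2 ^ (k ^ d)) ^ (d + 4) := by
        rw [show (d + 6 + j) * k ^ d = 2 * k ^ d + j * k ^ d + k ^ d * (d + 4) by ring,
          pow_add, pow_add, pow_mul _ (k ^ d) (d + 4)]
        field_simp
      _ ≤ 1 / 2 ^ j / (k : ℝ) ^ (d + 4) := by gcongr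
      _ ≤ δ / (k : ℝ) ^ (d + 4) := by
        rw [one_div_pow] at hj
        gcongr

end StablePercolation

namespace StablePercolation

/-! ### Claimed sites lie in bad cells -/

variable {d : ℕ} {S : Set (Site d)} {α : ℝ≥0∞} {ψ : Site d → Assignment d} {ε : ℝ}

/-- If `y` is in the territory of `ξ`, then `ξ` covets all sites closer than `y`. By stability such
a site is (up to the null set of undecided sites) allocated to a center not farther from it
than `ξ`, so that the ball of radius `dist y ξ` about `ξ` is covered by the territories of the
centers in the ball of twice the radius. -/
lemma volume_ball_le_of_mem_territory (hψ : IsStableAllocation S α ψ) {y ξ : Site d}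
    (hy : y ∈ territory ψ ξ) {n : ℕ}
    (hn : pointCount S (Metric.ball ξ (2 * dist y ξ)) ≤ n) :
    volume (Metric.ball ξ (dist y ξ)) ≤ n * α := by
  have hfin : (S ∩ Metric.ball ξ (2 * dist y ξ)).Finite :=
    Set.encard_lt_top_iff.1 (hn.trans_lt (ENat.natCast_lt_top n))
  have hcard : hfin.toFinset.card ≤ n := by
    have : ((hfin.toFinset.card : ℕ) : ℕ∞) ≤ n := by
      rw [← hfin.encard_eq_coe_toFinset_card]; exact hn
    exact_mod_cast this
  have hξ : ξ ∈ S := hψ.mem_of_eq_center y ξ hy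
  have hsub : Metric.ball ξ (dist y ξ) ⊆ {x | ψ x = Assignment.undecided} ∪
      ⋃ η ∈ hfin.toFinset, territory ψ η := by
    intro x hx
    have hnd : ¬ Desires ψ x ξ := fun h => hψ.stable x ξ hξ ⟨h, .inl ⟨y, hy, hx⟩⟩
    cases hc : ψ x with
    | undecided => exact .inl hc
    | unclaimed => exact absurd (.inl hc) hnd
    | center η =>
      refine .inr (Set.mem_biUnion (x := η) ?_ hc)
      simp only [Set.Finite.coe_toFinset]
      refine ⟨hψ.mem_of_eq_center x η hc, ?_⟩
      have h1 : dist x η ≤ dist x ξ := not_lt.1 fun h => hnd (.inr ⟨η, hc, h⟩)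
      have h2 := dist_triangle_left η ξ x
      rw [Metric.mem_ball] at hx ⊢
      linarith
  calc volume (Metric.ball ξ (dist y ξ))
      ≤ volume {x | ψ x = Assignment.undecided} +
          volume (⋃ η ∈ hfin.toFinset, territory ψ η) :=
        (measure_mono hsub).trans (measure_union_le _ _)
    _ ≤ 0 + ∑ η ∈ hfin.toFinset, volume (territory ψ η) :=
        add_le_add hψ.volume_undecided.le (measure_biUnion_finset_le _ _)
    _ ≤ ∑ _η ∈ hfin.toFinset, α := by
        rw [zero_add]
        exact Finset.sum_le_sum fun η hη =>
          hψ.volume_territory_le η (hfin.mem_toFinset.1 hη).1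
    _ = hfin.toFinset.card * α := by simp
    _ ≤ n * α := by gcongr

lemma cell_mem_box_of_dist_le (hε : 0 < ε) {x y : Site d} {k : ℕ} (h : dist x y ≤ k * ε) :
    cell ε y ∈ box (cell ε x) k := by
  rw [mem_box]
  intro i
  have h1 : |x i - y i| ≤ k * ε := by
    have := PiLp.norm_apply_le (x - y) i
    rw [← dist_eq_norm] at this
    exact this.trans h
  have h2 : |x i / ε - y i / ε| ≤ k := by
    rwa [← sub_div, abs_div, abs_of_pos hε, div_le_iff₀ hε]
  rw [abs_le] at h2
  have h3 : ⌊x i / ε⌋ ≤ ⌊y i / ε + k⌋ := Int.floor_mono (by linarith)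
  have h4 : ⌊y i / ε⌋ ≤ ⌊x i / ε + k⌋ := Int.floor_mono (by linarith)
  rw [Int.floor_add_natCast] at h3 h4
  simp only [cell]
  constructor <;> linarith

/-- If the appetite is small compared with the volume of a cell, then all cells that meet the
set of claimed sites are bad. -/
lemma cell_mem_badCells (hd : 1 ≤ d) (hε : 0 < ε) {M : ℕ}
    (hα : M * α ≤ ENNReal.ofReal ((ε / 2) ^ d) * volume (Metric.ball (0 : Site d) 1))
    (hψ : IsStableAllocation S α ψ) {x : Site d} (hx : x ∈ claimedSites ψ) :
    cell ε x ∈ badCells (threshold d M) (cellCount ε S) Set.univ := by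
  obtain ⟨y, ⟨ξ, hy⟩, hxy⟩ := Metric.mem_closure_iff.1 hx ε hε
  have hξ : ξ ∈ S := hψ.mem_of_eq_center y ξ hy
  have : Nonempty (Fin d) := ⟨⟨0, hd⟩⟩
  set R := dist y ξ with hR
  set k := max 1 ⌈R / ε⌉₊ with hk
  have hk1 : 1 ≤ k := le_max_left _ _
  have hRk : R ≤ k * ε := by
    rw [← div_le_iff₀ hε]
    exact (Nat.le_ceil _).trans (by exact_mod_cast le_max_right _ _)
  refine ⟨k, trivial, hk1, cell ε ξ, ?_, ?_⟩
  · have h1 : cell ε y ∈ box (cell ε x) 1 :=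
      cell_mem_box_of_dist_le hε (by simpa using hxy.le)
    exact box_trans h1 (cell_mem_box_of_dist_le hε hRk) (by omega)
  have hball : Metric.ball ξ (2 * R) ⊆ {x | cell ε x ∈ box (cell ε ξ) (3 * k)} := by
    intro a ha
    rw [Metric.mem_ball'] at ha
    have : cell ε a ∈ box (cell ε ξ) (2 * k) :=
      cell_mem_box_of_dist_le hε (by push_cast; linarith)
    exact box_trans this (mem_box_self _ 0) (by omega)
  rw [Dense, sum_cellCount]
  rcases hk1.eq_or_lt with hk1 | hk2
  · rw [← hk1, threshold, if_pos le_rfl, Nat.cast_one, pointCount, Set.one_le_encard_iff_nonempty]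
    exact ⟨ξ, hξ, mem_box_self _ _⟩
  · refine le_trans ?_ (Set.encard_le_encard (Set.inter_subset_inter_right S hball))
    rw [threshold, if_neg (by omega)]
    by_contra! hlt
    obtain ⟨n, hn⟩ := ENat.ne_top_iff_exists.1 hlt.ne_top
    rw [← hn] at hlt
    have hlt' : n < M * k ^ d := by exact_mod_cast hlt
    have hvol := volume_ball_le_of_mem_territory hψ hy (n := n) hn.ge
    -- the radius is at least half of `k * ε`, since `k ≥ 2` is the least integer above `R / ε`
    have hRge : k * (ε / 2) ≤ R := by
      have hkc : k = ⌈R / ε⌉₊ := by omega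
      have h1 : ((k - 1 : ℕ) : ℝ) < R / ε := Nat.lt_ceil.1 (by omega)
      rw [Nat.cast_sub (by omega), lt_div_iff₀ hε] at h1
      have h2 : (2 : ℝ) ≤ k := by exact_mod_cast hk2
      push_cast at h1
      nlinarith
    set c := ENNReal.ofReal ((ε / 2) ^ d) * volume (Metric.ball (0 : Site d) 1) with hc
    have hc0 : c ≠ 0 := by
      refine mul_ne_zero ?_ (Metric.measure_ball_pos _ _ one_pos).ne'
      rw [ENNReal.ofReal_ne_zero_iff]; positivity
    have hctop : c ≠ ∞ := ENNReal.mul_ne_top ENNReal.ofReal_ne_top measure_ball_lt_top.ne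
    have hvol' : (k ^ d : ℕ) * c ≤ n * α := by
      refine le_trans ?_ hvol
      rw [← hR, Measure.addHaar_ball volume ξ dist_nonneg, finrank_euclideanSpace,
        Fintype.card_fin, hc, ← mul_assoc]
      gcongr
      rw [← ENNReal.ofReal_natCast, ← ENNReal.ofReal_mul (by positivity)]
      refine ENNReal.ofReal_le_ofReal ?_
      push_cast
      rw [← mul_pow]
      gcongr
    have h3 : ((M * k ^ d : ℕ) : ℝ≥0∞) * c ≤ n * c := by
      calc ((M * k ^ d : ℕ) : ℝ≥0∞) * c = M * ((k ^ d : ℕ) * c) := by push_cast; ring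
        _ ≤ M * (n * α) := by gcongr
        _ = n * (M * α) := by ring
        _ ≤ n * c := by gcongr
    rw [ENNReal.mul_le_mul_iff_left hc0 hctop] at h3
    have : M * k ^ d ≤ n := by exact_mod_cast h3
    omega

/-! ### Connected sets of sites and paths of cells -/

lemma reach_cell_of_isPreconnected {B : Set (Fin d → ℤ)} {A : Set (Site d)} (hε : 0 < ε)
    (hA : IsPreconnected A) (hAB : ∀ x ∈ A, cell ε x ∈ B) {x y : Site d} (hx : x ∈ A)
    (hy : y ∈ A) : Reach Near B (cell ε x) (cell ε y) := by
  refine hA.induction₂' (fun x y => Reach Near B (cell ε x) (cell ε y)) (fun x hx => ?_)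
    (fun _ _ _ _ _ _ h h' => h.trans h') hx hy
  filter_upwards [self_mem_nhdsWithin, mem_nhdsWithin_of_mem_nhds (Metric.ball_mem_nhds x hε)]
    with y hy hxy
  have h : Near (cell ε x) (cell ε y) :=
    cell_mem_box_of_dist_le hε (by simpa using (Metric.mem_ball'.1 hxy).le)
  exact ⟨.single (hAB x hx) h (hAB y hy), .single (hAB y hy) h.symm (hAB x hx)⟩

lemma isBounded_cell_mem_box (hε : 0 < ε) (z : Fin d → ℤ) (r : ℕ) :
    Bornology.IsBounded {x : Site d | cell ε x ∈ box z r} := by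
  have hK : IsCompact ((WithLp.toLp 2 : (Fin d → ℝ) → Site d) ''
      (Set.univ.pi fun i => Set.Icc ((z i - r) * ε) ((z i + r + 1) * ε))) :=
    (isCompact_univ_pi fun _ => isCompact_Icc).image (PiLp.continuous_toLp 2 _)
  refine hK.isBounded.subset fun x hx => ⟨x.ofLp, fun i hi => ?_, rfl⟩
  exact Set.Ico_subset_Icc_self (cell_mem_box_subset hε z r hx i hi)

lemma exists_reach_of_claimedPercolation {B : Set (Fin d → ℤ)} (hε : 0 < ε)
    (hB : ∀ x ∈ claimedSites ψ, cell ε x ∈ B) (h : ClaimedPercolation ψ) :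
    ∃ z, ∀ r, ∃ v ∉ box z r, Reach Near B z v := by
  obtain ⟨A, hA, hconn, hunb⟩ := h
  obtain ⟨x, hx⟩ := hconn.nonempty
  refine ⟨cell ε x, fun r => ?_⟩
  by_contra! hc
  refine hunb ((isBounded_cell_mem_box hε (cell ε x) r).subset fun y hy => ?_)
  by_contra hy'
  exact hc _ hy' (reach_cell_of_isPreconnected hε hconn.isPreconnected
    (fun a ha => hB a (hA ha)) hx hy)

/-- Two cells of the lattice that share a face of dimension `d - 1`. -/
def FaceAdj (u v : Fin d → ℤ) : Prop :=
  ∃ i, (v i = u i + 1 ∨ u i = v i + 1) ∧ ∀ j ≠ i, u j = v j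

/-- The center of a cell. -/
noncomputable def cellCenter (ε : ℝ) (w : Fin d → ℤ) : Site d :=
  WithLp.toLp 2 fun i => (w i + 1 / 2) * ε

lemma cell_cellCenter (hε : 0 < ε) (w : Fin d → ℤ) : cell ε (cellCenter ε w) = w := by
  ext i
  simp only [cell, cellCenter]
  rw [mul_div_cancel_right₀ _ hε.ne', Int.floor_eq_iff]
  constructor <;> linarith

lemma cell_mem_pair_of_mem_segment (hε : 0 < ε) {u v : Fin d → ℤ} (huv : FaceAdj u v) {x : Site d}
    (hx : x ∈ segment ℝ (cellCenter ε u) (cellCenter ε v)) : cell ε x = u ∨ cell ε x = v := by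
  obtain ⟨i, hi, hj⟩ := huv
  obtain ⟨a, b, ha, hb, hab, rfl⟩ := hx
  obtain rfl : a = 1 - b := by linarith
  have hcoord : ∀ j, ((1 - b) • cellCenter ε u + b • cellCenter ε v : Site d) j / ε =
      u j + 1 / 2 + b * (v j - u j) := by
    intro j
    simp only [cellCenter, PiLp.add_apply, PiLp.smul_apply, smul_eq_mul]
    field_simp
    ring
  have hcell : ∀ j, cell ε ((1 - b) • cellCenter ε u + b • cellCenter ε v : Site d) j =
      ⌊(u j : ℝ) + 1 / 2 + b * (v j - u j)⌋ := fun j => by rw [cell, hcoord]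
  have hother : ∀ j ≠ i, cell ε ((1 - b) • cellCenter ε u + b • cellCenter ε v : Site d) j =
      u j := by
    intro j hji
    rw [hcell, ← hj j hji, Int.floor_eq_iff]
    constructor <;> linarith
  have hi' : cell ε ((1 - b) • cellCenter ε u + b • cellCenter ε v : Site d) i = u i ∨
      cell ε ((1 - b) • cellCenter ε u + b • cellCenter ε v : Site d) i = v i := by
    rw [hcell]
    rcases hi with hi | hi <;> rw [hi] <;> push_cast <;>
      rcases lt_or_ge b (1 / 2) with h | h
    · left; rw [Int.floor_eq_iff]; constructor <;> nlinarith
    · right; rw [Int.floor_eq_iff]; push_cast; constructor <;> nlinarith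
    · left; rw [Int.floor_eq_iff]; push_cast; constructor <;> nlinarith
    · rcases h.eq_or_lt with rfl | h
      · left; rw [Int.floor_eq_iff]; push_cast; constructor <;> nlinarith
      · right; rw [Int.floor_eq_iff]; constructor <;> nlinarith
  refine hi'.imp (fun h => ?_) (fun h => ?_)
  · ext j
    by_cases hji : j = i
    · rw [hji, h]
    · exact hother j hji
  · ext j
    by_cases hji : j = i
    · rw [hji, h]
    · rw [hother j hji, hj j hji]

/-- An infinite set of cells that are joined through faces and do not meet the set of claimed
sites gives an unbounded component of the complement. -/
lemma unclaimedPercolation_of_infinite {B : Set (Fin d → ℤ)} (hε : 0 < ε)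
    (hB : ∀ x ∈ claimedSites ψ, cell ε x ∈ B) {w : Fin d → ℤ} (hw : w ∉ B)
    (hinf : {v | Reach FaceAdj Bᶜ w v}.Infinite) : UnclaimedPercolation ψ := by
  have hmem : ∀ v ∉ B, cellCenter ε v ∈ (claimedSites ψ)ᶜ := fun v hv h => hv <| by
    simpa [cell_cellCenter hε] using hB _ h
  refine ⟨cellCenter ε w, hmem w hw, fun hbdd => hinf ?_⟩
  have hcomp : ∀ v, Reach FaceAdj Bᶜ w v →
      cellCenter ε v ∈ connectedComponentIn (claimedSites ψ)ᶜ (cellCenter ε w) := by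
    intro v hv
    rw [hv.apply_eq (fun v => connectedComponentIn (claimedSites ψ)ᶜ (cellCenter ε v)) ?_]
    · exact mem_connectedComponentIn (hmem v hv.mem_right)
    · intro a ha b hb hab
      refine connectedComponentIn_eq ?_
      have hsub : segment ℝ (cellCenter ε a) (cellCenter ε b) ⊆ (claimedSites ψ)ᶜ := by
        intro x hx hx'
        rcases cell_mem_pair_of_mem_segment hε hab hx with h | h
        · exact ha (h ▸ hB x hx')
        · exact hb (h ▸ hB x hx')
      exact (convex_segment (𝕜 := ℝ) _ _).isPreconnected.subset_connectedComponentIn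
        (left_mem_segment ℝ _ _) hsub (right_mem_segment ℝ _ _)
  obtain ⟨R, hR⟩ := hbdd.subset_closedBall (cellCenter ε w)
  refine (box w ⌈R / ε⌉₊).finite_toSet.subset fun v hv => ?_
  have h := hR (hcomp v hv)
  have := cell_mem_box_of_dist_le (k := ⌈R / ε⌉₊) hε
    ((Metric.mem_closedBall'.1 h).trans ((div_le_iff₀ hε).1 (Nat.le_ceil _)))
  simpa [cell_cellCenter hε] using this

end StablePercolation

namespace StablePercolation

/-! ### Planar duality -/

/-- Nearest neighbours in the square lattice. -/
def Adj4 (u v : ℤ × ℤ) : Prop :=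
  (u.1 = v.1 ∧ (v.2 = u.2 + 1 ∨ u.2 = v.2 + 1)) ∨ (u.2 = v.2 ∧ (v.1 = u.1 + 1 ∨ u.1 = v.1 + 1))

/-- Neighbours, diagonal ones included, in the square lattice. A vertex is a neighbour of itself. -/
def Adj8 (u v : ℤ × ℤ) : Prop :=
  (u.1 ≤ v.1 + 1 ∧ v.1 ≤ u.1 + 1) ∧ (u.2 ≤ v.2 + 1 ∧ v.2 ≤ u.2 + 1)

lemma Adj4.symm {u v : ℤ × ℤ} (h : Adj4 u v) : Adj4 v u := by
  unfold Adj4 at *; omega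

lemma Adj8.symm {u v : ℤ × ℤ} (h : Adj8 u v) : Adj8 v u := by
  unfold Adj8 at *; omega

lemma exists_add_one_eq_add {G : Type*} [AddCommGroup G] (f : ℤ → G) :
    ∃ F : ℤ → G, F 0 = 0 ∧ ∀ x, F (x + 1) = F x + f x := by
  refine ⟨fun x => ∑ t ∈ Finset.Ico 0 x, f t - ∑ t ∈ Finset.Ico x 0, f t, by simp, fun x => ?_⟩
  beta_reduce
  rcases le_or_gt 0 x with hx | hx
  · have h1 : Finset.Ico 0 (x + 1) = insert x (Finset.Ico 0 x) := by
      ext t; simp only [Finset.mem_Ico, Finset.mem_insert]; omega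
    rw [h1, Finset.sum_insert (by simp), Finset.Ico_eq_empty (by omega : ¬ x + 1 < 0),
      Finset.Ico_eq_empty (by omega : ¬ x < 0)]
    simp [add_comm]
  · have h1 : Finset.Ico x 0 = insert x (Finset.Ico (x + 1) 0) := by
      ext t; simp only [Finset.mem_Ico, Finset.mem_insert]; omega
    rw [h1, Finset.sum_insert (by simp), Finset.Ico_eq_empty (by omega : ¬ 0 < x + 1),
      Finset.Ico_eq_empty (by omega : ¬ 0 < x)]
    simp

/-- A discrete Poincaré lemma: a function on the edges of the square lattice whose circulation
around each unit square vanishes is the gradient of a function on the vertices. -/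
lemma exists_potential {G : Type*} [AddCommGroup G] (fh fv : ℤ → ℤ → G)
    (h : ∀ x y, fh x y + fv (x + 1) y = fv x y + fh x (y + 1)) :
    ∃ g : ℤ → ℤ → G, (∀ x y, g (x + 1) y = g x y + fh x y) ∧
      ∀ x y, g x (y + 1) = g x y + fv x y := by
  obtain ⟨H, -, hH⟩ := exists_add_one_eq_add fun x => fh x 0
  choose V hV0 hV using fun x => exists_add_one_eq_add (fv x)
  refine ⟨fun x y => H x + V x y, fun x y => ?_, fun x y => by
    beta_reduce
    rw [hV, add_assoc]⟩
  have key : ∀ y, V (x + 1) y + fh x 0 = V x y + fh x y := by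
    intro y
    induction y using Int.induction_on with
    | zero => simp [hV0]
    | succ y ih =>
      have h1 := h x y
      rw [hV, hV]
      calc V (x + 1) y + fv (x + 1) y + fh x 0 = (V (x + 1) y + fh x 0) + fv (x + 1) y := by abel
        _ = V x y + (fh x y + fv (x + 1) y) := by rw [ih]; abel
        _ = _ := by rw [h1]; abel
    | pred y ih =>
      have h1 := h x (-y - 1)
      have h2 := hV (x + 1) (-y - 1)
      have h3 := hV x (-y - 1)
      rw [sub_add_cancel] at h1 h2 h3
      rw [h2, h3] at ih
      have : V (x + 1) (-y - 1) + fh x 0 + fv (x + 1) (-y - 1) =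
          V x (-y - 1) + fh x (-y - 1) + fv (x + 1) (-y - 1) := by
        calc _ = V (x + 1) (-y - 1) + fv (x + 1) (-y - 1) + fh x 0 := by abel
          _ = _ := by rw [ih, add_assoc _ (fh x (-y - 1)), h1]; abel
      exact add_right_cancel this
  beta_reduce
  rw [hH]
  calc H x + fh x 0 + V (x + 1) y = H x + (V (x + 1) y + fh x 0) := by abel
    _ = _ := by rw [key]; abel

/-- Let `A` and `D` be disjoint connected sets of vertices of the square lattice such that all
neighbours of `D` outside `D` are in `A`. Then the vertices of `D` with a neighbour in `A` form a
set that is connected with diagonal steps. If they fell into two classes, then the edges between `A`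
and one of the classes would meet each unit square an even number of times and so, modulo 2, would
be the gradient of a function. This function is constant on `A` and on `D`, but its increment from
`A` to `D` depends on the class. -/
theorem reach_boundary {A D : Set (ℤ × ℤ)} (hA : ∀ u ∈ A, ∀ v ∈ A, Reach Adj4 A u v)
    (hD : ∀ u ∈ D, ∀ v ∈ D, Reach Adj4 D u v) (hdisj : Disjoint A D)
    (hDA : ∀ u ∈ D, ∀ v ∉ D, Adj4 u v → v ∈ A) {p q : ℤ × ℤ}
    (hp : p ∈ {v ∈ D | ∃ u ∈ A, Adj4 v u}) (hq : q ∈ {v ∈ D | ∃ u ∈ A, Adj4 v u}) :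
    Reach Adj8 {v ∈ D | ∃ u ∈ A, Adj4 v u} p q := by
  classical
  set B := {v ∈ D | ∃ u ∈ A, Adj4 v u} with hB
  set B₁ := {v | Reach Adj8 B p v} with hB₁
  by_contra hpq
  have hB₁B : B₁ ⊆ B := fun v hv => Reach.mem_right hv
  have hnot : ∀ v ∈ D, v ∉ A := fun v hv hv' => Set.disjoint_left.1 hdisj hv' hv
  set f : ℤ × ℤ → ℤ × ℤ → ZMod 2 := fun u v =>
    if (u ∈ A ∧ v ∈ B₁) ∨ (v ∈ A ∧ u ∈ B₁) then 1 else 0 with hf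
  set χ : ℤ × ℤ → ZMod 2 := fun u => if u ∈ D then 1 else 0 with hχ
  have h2 : (2 : ZMod 2) = 0 := rfl
  have hf_symm : ∀ u v, f u v = f v u := by
    intro u v
    simp only [hf, or_comm]
  have hf_zero : ∀ u v, u ∉ B₁ → v ∉ B₁ → f u v = 0 := by
    intro u v hu hv
    simp [hf, hu, hv]
  -- near a vertex of `B₁`, the edge function is the gradient of the indicator of `D`
  have hf_edge : ∀ u v b, b ∈ B₁ → Adj8 b u → Adj8 b v → Adj4 u v → f u v = χ u + χ v := by
    intro u v b hb hbu hbv huv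
    by_cases hu : u ∈ D <;> by_cases hv : v ∈ D
    · simp [hf, hχ, hu, hv, hnot u hu, hnot v hv]
      exact h2.symm
    · have hvA := hDA u hu v hv huv
      have huB : u ∈ B₁ := Reach.tail hb hbu ⟨hu, v, hvA, huv⟩
      simp [hf, hχ, hu, hv, hvA, huB]
    · have huA := hDA v hv u hu huv.symm
      have hvB : v ∈ B₁ := Reach.tail hb hbv ⟨hv, u, huA, huv.symm⟩
      simp [hf, hχ, hu, hv, huA, hvB]
    · have hu' : u ∉ B₁ := fun h => hu (hB₁B h).1
      have hv' : v ∉ B₁ := fun h => hv (hB₁B h).1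
      simp [hf, hχ, hu, hv, hu', hv']
  obtain ⟨g, hgh, hgv⟩ := exists_potential (fun x y => f (x, y) (x + 1, y))
    (fun x y => f (x, y) (x, y + 1)) (by
      intro x y
      by_cases hex : ∃ b ∈ B₁, (b.1 = x ∨ b.1 = x + 1) ∧ (b.2 = y ∨ b.2 = y + 1)
      · obtain ⟨b, hb, hbx, hby⟩ := hex
        rw [hf_edge (x, y) (x + 1, y) b hb, hf_edge (x + 1, y) (x + 1, y + 1) b hb,
          hf_edge (x, y) (x, y + 1) b hb, hf_edge (x, y + 1) (x + 1, y + 1) b hb]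
        · linear_combination (χ (x + 1, y) - χ (x, y + 1)) * h2
        all_goals first | simp [Adj4] | (simp only [Adj8]; omega)
      · push Not at hex
        have hn : ∀ x' y', (x' = x ∨ x' = x + 1) → (y' = y ∨ y' = y + 1) → (x', y') ∉ B₁ :=
          fun x' y' hx' hy' hb => by
            have := hex _ hb hx'
            simp only at this
            omega
        rw [hf_zero, hf_zero, hf_zero, hf_zero] <;> apply hn <;> simp)
  have hg : ∀ u v : ℤ × ℤ, Adj4 u v → g v.1 v.2 = g u.1 u.2 + f u v := by
    rintro ⟨x, y⟩ ⟨x', y'⟩ h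
    simp only [Adj4] at h
    rcases h with ⟨rfl, rfl | rfl⟩ | ⟨rfl, rfl | rfl⟩
    · exact hgv x y
    · simp only
      rw [hgv x y', hf_symm (x, y' + 1)]
      linear_combination (-f (x, y') (x, y' + 1)) * h2
    · exact hgh x y
    · simp only
      rw [hgh x' y, hf_symm (x' + 1, y)]
      linear_combination (-f (x', y) (x' + 1, y)) * h2
  have hgA : ∀ u ∈ A, ∀ v ∈ A, g u.1 u.2 = g v.1 v.2 := fun u hu v hv =>
    (hA u hu v hv).apply_eq (fun u => g u.1 u.2) fun a ha b hb hab => by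
      rw [hg a b hab, hf_zero a b (fun h => hnot a (hB₁B h).1 ha) (fun h => hnot b (hB₁B h).1 hb),
        add_zero]
  have hgD : ∀ u ∈ D, ∀ v ∈ D, g u.1 u.2 = g v.1 v.2 := fun u hu v hv =>
    (hD u hu v hv).apply_eq (fun u => g u.1 u.2) fun a ha b hb hab => by
      rw [hg a b hab]
      simp [hf, hnot a ha, hnot b hb]
  obtain ⟨hpD, a, ha, hpa⟩ := hp
  obtain ⟨hqD, c, hc, hqc⟩ := hq
  have hpB : p ∈ B₁ := Reach.refl ⟨hpD, a, ha, hpa⟩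
  have e1 : f p a = 1 := by simp [hf, ha, hpB]
  have e2 : f q c = 0 := hf_zero q c hpq fun h => hnot c (hB₁B h).1 hc
  have e3 := hg p a hpa
  have e4 := hg q c hqc
  rw [e1] at e3
  rw [e2, add_zero, ← hgA a ha c hc, ← hgD p hpD q hqD, e3] at e4
  simp at e4

lemma reach_horizontal {S : Set (ℤ × ℤ)} {x x' y : ℤ} (hx : x ≤ x')
    (h : ∀ i, x ≤ i → i ≤ x' → (i, y) ∈ S) : Reach Adj4 S (x, y) (x', y) := by
  induction x', hx using Int.leInduction with
  | base => exact .refl (h x le_rfl le_rfl)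
  | succ k hk ih =>
    exact (ih fun i hi hi' => h i hi (by omega)).tail (by simp [Adj4]) (h _ (by omega) le_rfl)

lemma reach_vertical {S : Set (ℤ × ℤ)} {x y y' : ℤ} (hy : y ≤ y')
    (h : ∀ i, y ≤ i → i ≤ y' → (x, i) ∈ S) : Reach Adj4 S (x, y) (x, y') := by
  induction y', hy using Int.leInduction with
  | base => exact .refl (h y le_rfl le_rfl)
  | succ k hk ih =>
    exact (ih fun i hi hi' => h i hi (by omega)).tail (by simp [Adj4]) (h _ (by omega) le_rfl)

/-- If all components of `G` are finite, then the segment from `(0, 0)` to `(N, 0)` is surrounded by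
a path with diagonal steps outside `G`. Such a path is provided by the outer boundary of the union
of the segment and the components of `G` adjacent to it. -/
theorem exists_reach_compl {G : Set (ℤ × ℤ)} (hG : ∀ u ∈ G, {v | Reach Adj4 G u v}.Finite) (N : ℕ) :
    ∃ a b : ℕ, 1 ≤ a ∧ 1 ≤ b ∧ Reach Adj8 Gᶜ (-(a : ℤ), 0) ((N : ℤ) + b, 0) := by
  have symm4 : ∀ a b, Adj4 a b → Adj4 b a := fun _ _ => Adj4.symm
  set A : Set (ℤ × ℤ) := {v | ∃ i : ℤ, (0 ≤ i ∧ i ≤ N) ∧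
    (v = (i, 0) ∨ ∃ w ∈ G, Adj4 (i, 0) w ∧ Reach Adj4 G w v)} with hA
  have hseg : ∀ i : ℤ, 0 ≤ i → i ≤ N → (i, 0) ∈ A := fun i hi hi' => ⟨i, ⟨hi, hi'⟩, .inl rfl⟩
  have hfin : A.Finite := by
    have hnbr : ∀ i : ℤ, {w | w ∈ G ∧ Adj4 (i, 0) w}.Finite := by
      intro i
      refine Set.Finite.subset
        (Set.toFinite {((i, 1) : ℤ × ℤ), (i, -1), (i + 1, 0), (i - 1, 0)}) ?_
      rintro ⟨x, y⟩ ⟨-, h⟩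
      simp only [Adj4] at h
      simp only [Set.mem_insert_iff, Set.mem_singleton_iff, Prod.mk.injEq]
      omega
    refine ((Set.finite_Icc (0 : ℤ) N).biUnion fun i _ => (Set.finite_singleton (i, (0 : ℤ))).union
      ((hnbr i).biUnion fun w hw => hG w hw.1)).subset ?_
    rintro v ⟨i, hi, hv | ⟨w, hw, hiw, hv⟩⟩
    · exact Set.mem_biUnion (x := i) hi (.inl hv)
    · exact Set.mem_biUnion (x := i) hi (.inr (Set.mem_biUnion (x := w) ⟨hw, hiw⟩ hv))
  -- neighbours of `A` outside `A` are not in `G`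
  have hout : ∀ u ∈ A, ∀ v ∉ A, Adj4 u v → v ∉ G := by
    rintro u ⟨i, hi, rfl | ⟨w, hw, hiw, hu⟩⟩ v hv huv hvG
    · exact hv ⟨i, hi, .inr ⟨v, hvG, huv, .refl hvG⟩⟩
    · exact hv ⟨i, hi, .inr ⟨w, hw, hiw, hu.tail huv hvG⟩⟩
  have hA0 : ∀ v ∈ A, Reach Adj4 A (0, 0) v := by
    rintro v ⟨i, hi, hv⟩
    have h0 : Reach Adj4 A (0, 0) (i, 0) :=
      reach_horizontal hi.1 fun j hj hj' => hseg j hj (by omega)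
    rcases hv with rfl | ⟨w, hw, hiw, hv⟩
    · exact h0
    · have hwA : ∀ v, Reach Adj4 G w v → v ∈ A := fun v hv => ⟨i, hi, .inr ⟨w, hw, hiw, hv⟩⟩
      have hwv : Reach Adj4 A w v := by
        obtain ⟨-, hv⟩ := hv
        induction hv with
        | refl => exact .refl (hwA w (.refl hw))
        | tail h1 h2 ih => exact ih.tail h2.1 (hwA _ (Reach.tail ⟨hw, h1⟩ h2.1 h2.2))
      exact (h0.tail hiw (hwA w (.refl hw))).trans hwv
  have hAconn : ∀ u ∈ A, ∀ v ∈ A, Reach Adj4 A u v := fun u hu v hv =>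
    ((hA0 u hu).symm symm4).trans (hA0 v hv)
  obtain ⟨r, hr⟩ : ∃ r : ℤ, ∀ v ∈ A, |v.1| < r ∧ |v.2| < r := by
    obtain ⟨r, hr⟩ := (hfin.image fun v => |v.1| + |v.2|).bddAbove
    refine ⟨r + 1, fun v hv => ?_⟩
    have h1 : |v.1| + |v.2| ≤ r := hr ⟨v, hv, rfl⟩
    have h2 := abs_nonneg v.1
    have h3 := abs_nonneg v.2
    omega
  have hfar : ∀ x y : ℤ, (r ≤ |x| ∨ r ≤ |y|) → (x, y) ∈ Aᶜ := fun x y h hmem => by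
    have := hr _ hmem
    simp only at this
    omega
  -- the last points of `A` on the axis to the left and to the right of the segment
  obtain ⟨l, hl, hlmax⟩ := Int.exists_greatest_of_bdd (P := fun z => (-z, (0 : ℤ)) ∈ A)
    ⟨r, fun z hz => by have := (hr _ hz).1; simp only [abs_neg] at this; have := le_abs_self z; omega⟩
    ⟨0, by simpa using hseg 0 le_rfl (by omega)⟩
  obtain ⟨t, ht, htmax⟩ := Int.exists_greatest_of_bdd (P := fun z => (N + z, (0 : ℤ)) ∈ A)
    ⟨r, fun z hz => by have := (hr _ hz).1; have := le_abs_self (N + z); simp only at *; omega⟩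
    ⟨0, by simpa using hseg N (by omega) le_rfl⟩
  have hl0 : 0 ≤ l := hlmax 0 (by simpa using hseg 0 le_rfl (by omega))
  have ht0 : 0 ≤ t := htmax 0 (by simpa using hseg N (by omega) le_rfl)
  have hlr : l < r := by
    have := (hr _ hl).1; simp only [abs_neg] at this; have := le_abs_self l; omega
  have htr : N + t < r := by
    have := (hr _ ht).1; have := le_abs_self (N + t); simp only at *; omega
  set p : ℤ × ℤ := (-(l + 1), 0) with hp
  set q : ℤ × ℤ := (N + (t + 1), 0) with hq
  have hleft : ∀ i : ℤ, i ≤ -(l + 1) → (i, 0) ∈ Aᶜ := fun i hi hmem => by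
    have := hlmax (-i) (by simpa using hmem)
    omega
  have hright : ∀ i : ℤ, N + (t + 1) ≤ i → (i, 0) ∈ Aᶜ := fun i hi hmem => by
    have := htmax (i - N) (by simpa using hmem)
    omega
  -- going around `A` far away from it
  have hpq : Reach Adj4 Aᶜ p q := by
    have h1 : Reach Adj4 Aᶜ (-r, 0) p :=
      reach_horizontal (by omega) fun i _ hi => hleft i hi
    have h2 : Reach Adj4 Aᶜ (-r, 0) (-r, r) :=
      reach_vertical (by omega) fun i _ _ => hfar _ _ (.inl (by rw [abs_neg]; exact le_abs_self r))
    have h3 : Reach Adj4 Aᶜ (-r, r) (r, r) :=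
      reach_horizontal (by omega) fun i _ _ => hfar _ _ (.inr (le_abs_self r))
    have h4 : Reach Adj4 Aᶜ (r, 0) (r, r) :=
      reach_vertical (by omega) fun i _ _ => hfar _ _ (.inl (le_abs_self r))
    have h5 : Reach Adj4 Aᶜ q (r, 0) :=
      reach_horizontal (by omega) fun i hi _ => hright i hi
    exact (h1.symm symm4).trans (h2.trans (h3.trans ((h4.symm symm4).trans (h5.symm symm4))))
  set D : Set (ℤ × ℤ) := {v | Reach Adj4 Aᶜ p v} with hD
  have hDin : ∀ v, Reach Adj4 Aᶜ p v → Reach Adj4 D p v := by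
    rintro v ⟨hpA, hv⟩
    induction hv with
    | refl => exact .refl (Reach.refl hpA)
    | tail h1 h2 ih => exact ih.tail h2.1 (Reach.tail ⟨hpA, h1⟩ h2.1 h2.2)
  have hb := reach_boundary hAconn
    (fun u hu v hv => ((hDin u hu).symm symm4).trans (hDin v hv))
    (Set.disjoint_left.2 fun v hv hv' => (Reach.mem_right hv') hv)
    (fun u hu v hv huv => by_contra fun hvA => hv (Reach.tail hu huv hvA))
    (p := p) (q := q) ⟨Reach.refl hpq.1, (-l, 0), hl, .inr ⟨rfl, .inl (by simp only [hp]; ring)⟩⟩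
    ⟨hpq, (N + t, 0), ht, .inr ⟨rfl, .inr (by simp only [hq]; ring)⟩⟩
  refine ⟨(l + 1).toNat, (t + 1).toNat, by omega, by omega, ?_⟩
  rw [Int.toNat_of_nonneg (by omega), Int.toNat_of_nonneg (by omega)]
  refine hb.mono ?_
  rintro v ⟨hv, u, hu, hvu⟩
  exact hout u hu v (Reach.mem_right hv) hvu.symm

end StablePercolation

namespace StablePercolation

/-! ### Absence of unbounded clusters and the final argument -/

section BorelCantelli

variable {d : ℕ} {Ω : Type u} [MeasurableSpace Ω] {P : Measure Ω} {B : Ω → Set (Fin d → ℤ)}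

/-- Quadratic decay of the connection probabilities is summable, so that the Borel–Cantelli lemma
applies. -/
lemma ae_eventually_reach_mem_box {C : ℝ}
    (h : ∀ (r : ℕ) (x : Fin d → ℤ), 1 ≤ r →
      P {ω | ∃ v ∉ box x r, Reach Near (B ω) x v} ≤ ENNReal.ofReal (C / (r : ℝ) ^ 2))
    (x : ℕ → Fin d → ℤ) :
    ∀ᵐ ω ∂P, ∀ᶠ n in Filter.atTop, ∀ v, Reach Near (B ω) (x n) v → v ∈ box (x n) n := by
  have hsum : Summable fun n : ℕ => C / (n : ℝ) ^ 2 := by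
    simpa [div_eq_mul_inv] using (Real.summable_nat_pow_inv.2 one_lt_two).mul_left C
  -- the event for `n = 0` is left out, where the bound `C / 0 ^ 2 = 0` is void
  have hs : ∑' n : ℕ, P {ω | 1 ≤ n ∧ ∃ v ∉ box (x n) n, Reach Near (B ω) (x n) v} ≠ ∞ := by
    refine ne_top_of_le_ne_top hsum.tsum_ofReal_ne_top (ENNReal.tsum_le_tsum fun n => ?_)
    by_cases hn : 1 ≤ n
    · simpa [hn] using h n (x n) hn
    · simp [hn]
  filter_upwards [ae_eventually_notMem hs] with ω hω
  filter_upwards [hω, Filter.eventually_ge_atTop 1] with n hn hn1 v hv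
  by_contra hvn
  exact hn ⟨hn1, v, hvn, hv⟩

lemma ae_forall_exists_reach_mem_box {C : ℝ}
    (h : ∀ (r : ℕ) (x : Fin d → ℤ), 1 ≤ r →
      P {ω | ∃ v ∉ box x r, Reach Near (B ω) x v} ≤ ENNReal.ofReal (C / (r : ℝ) ^ 2)) :
    ∀ᵐ ω ∂P, ∀ x, ∃ r, ∀ v, Reach Near (B ω) x v → v ∈ box x r := by
  rw [ae_all_iff]
  intro x
  filter_upwards [ae_eventually_reach_mem_box h fun _ => x] with ω hω
  exact hω.exists

end BorelCantelli

variable {d : ℕ}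

/-- The embedding of the square lattice as a coordinate plane of `ℤ^d`. -/
def slice (d : ℕ) (u : ℤ × ℤ) : Fin d → ℤ :=
  fun i => if i.val = 0 then u.1 else if i.val = 1 then u.2 else 0

lemma slice_injective (hd : 2 ≤ d) : Function.Injective (slice d) := by
  intro u v h
  have h0 := congrFun h ⟨0, by omega⟩
  have h1 := congrFun h ⟨1, by omega⟩
  simp only [slice, if_true] at h0 h1
  exact Prod.ext h0 (by simpa using h1)

lemma near_slice {u v : ℤ × ℤ} (h : Adj8 u v) : Near (slice d u) (slice d v) := by
  unfold Adj8 at h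
  rw [Near, mem_box]
  intro i
  simp only [slice]
  split_ifs <;> omega

lemma faceAdj_slice (hd : 2 ≤ d) {u v : ℤ × ℤ} (h : Adj4 u v) :
    FaceAdj (slice d u) (slice d v) := by
  rcases h with ⟨h, h'⟩ | ⟨h, h'⟩
  · refine ⟨⟨1, by omega⟩, by simpa [slice] using h', fun j hj => ?_⟩
    have : j.val ≠ 1 := fun h => hj (Fin.ext h)
    simp [slice, h, this]
  · refine ⟨⟨0, by omega⟩, by simpa [slice] using h', fun j hj => ?_⟩
    have : j.val ≠ 0 := fun h => hj (Fin.ext h)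
    simp [slice, h, this]

/-- If clusters of bad cells are bounded, and the cluster of the point at distance `a` on a half-axis
has radius at most `a` for large `a`, then the good cells of a coordinate plane percolate: otherwise
bad cells would surround an arbitrarily long initial segment of the opposite half-axis. -/
lemma unclaimedPercolation_of_reach (hd : 2 ≤ d) {ψ : Site d → Assignment d}
    {B : Set (Fin d → ℤ)} {ε : ℝ} (hε : 0 < ε) (hB : ∀ x ∈ claimedSites ψ, cell ε x ∈ B)
    (h₁ : ∀ x, ∃ r, ∀ v, Reach Near B x v → v ∈ box x r)
    (h₂ : ∀ᶠ a : ℕ in Filter.atTop, ∀ v, Reach Near B (slice d (-(a : ℤ), 0)) v →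
      v ∈ box (slice d (-(a : ℤ), 0)) a) : UnclaimedPercolation ψ := by
  choose r hr using h₁
  obtain ⟨n, hn⟩ := Filter.eventually_atTop.1 h₂
  set N := ∑ a ∈ Finset.range n, r (slice d (-(a : ℤ), 0)) with hN
  have hbox : ∀ a : ℕ, ∀ v, Reach Near B (slice d (-(a : ℤ), 0)) v →
      v ∈ box (slice d (-(a : ℤ), 0)) (a + N) := by
    intro a v hv
    rcases lt_or_ge a n with ha | ha
    · have : r (slice d (-(a : ℤ), 0)) ≤ N :=
        Finset.single_le_sum (f := fun a : ℕ => r (slice d (-(a : ℤ), 0)))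
          (fun _ _ => Nat.zero_le _) (Finset.mem_range.2 ha)
      exact box_trans (hr _ v hv) (mem_box_self v 0) (by omega)
    · exact box_trans (hn a ha v hv) (mem_box_self v 0) (by omega)
  by_contra hperc
  have hfin : ∀ u ∈ {u | slice d u ∉ B}, {v | Reach Adj4 {u | slice d u ∉ B} u v}.Finite := by
    intro u hu
    by_contra hinf
    refine hperc (unclaimedPercolation_of_infinite hε hB hu ?_)
    refine (Set.Infinite.image (slice_injective hd).injOn hinf).mono ?_
    rintro _ ⟨v, hv, rfl⟩
    exact Reach.map (slice d) (fun _ _ => faceAdj_slice hd) (fun _ h => h) hv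
  obtain ⟨a, b, ha, hb, h⟩ := exists_reach_compl hfin N
  have h' := mem_box.1 (hbox a _ (h.map (slice d) (fun _ _ => near_slice)
    fun _ h => not_not.1 h)) ⟨0, by omega⟩
  simp only [slice, if_true] at h'
  omega

/-- For small appetites, the cells that meet the set of claimed sites belong to a random set of cells
whose connection probabilities decay quadratically. -/
theorem exists_appetite_forall_reach_le (hd : 1 ≤ d) :
    ∃ α₀ : ℝ≥0∞, 0 < α₀ ∧ ∃ ε : ℝ, 0 < ε ∧ ∃ m : ℕ → ℕ,
      (∀ α ≤ α₀, ∀ (S : Set (Site d)) (ψ : Site d → Assignment d), IsStableAllocation S α ψ →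
        ∀ x ∈ claimedSites ψ, cell ε x ∈ badCells m (cellCount ε S) Set.univ) ∧
      ∀ (Ω : Type u) [MeasurableSpace Ω] (P : Measure Ω) [IsProbabilityMeasure P]
        (Ξ : Ω → Set (Site d)), IsPoissonProcess P Ξ 1 → ∃ C : ℝ,
        ∀ (r : ℕ) (x : Fin d → ℤ), 1 ≤ r →
          P {ω | ∃ v ∉ box x r, Reach Near (badCells m (cellCount ε (Ξ ω)) Set.univ) x v} ≤
            ENNReal.ofReal (C / (r : ℝ) ^ 2) := by
  obtain ⟨ε, hε, M, hM, hD⟩ := exists_forall_measureReal_dense_le.{u} hd (denseLevel_pos d)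
  refine ⟨ENNReal.ofReal ((ε / 2) ^ d) * volume (Metric.ball (0 : Site d) 1) / M, ?_, ε, hε,
    threshold d M, fun α hα S ψ hψ x hx => ?_, fun Ω _ P _ Ξ hΞ => ?_⟩
  · refine ENNReal.div_pos (mul_ne_zero ?_ (Metric.measure_ball_pos _ _ one_pos).ne')
      (ENNReal.natCast_ne_top M)
    rw [ENNReal.ofReal_ne_zero_iff]; positivity
  · exact cell_mem_badCells hd hε (ENNReal.mul_le_of_le_div' hα) hψ hx
  · exact measure_reach_le (aemeasurable_cellCount hΞ hε) (iIndepFun_cellCount hΞ ε) (hD Ω P Ξ hΞ)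

theorem exists_forall_ae_not_claimedPercolation (hd : 1 ≤ d) :
    ∃ α₀ : ℝ≥0∞, 0 < α₀ ∧ ∀ α ≤ α₀,
      ∀ (Ω : Type u) [MeasurableSpace Ω] (P : Measure Ω) [IsProbabilityMeasure P]
        (Ξ : Ω → Set (Site d)), IsPoissonProcess P Ξ 1 →
        ∀ᵐ ω ∂P, ∀ ψ, IsStableAllocation (Ξ ω) α ψ → ¬ ClaimedPercolation ψ := by
  obtain ⟨α₀, hα₀, ε, hε, m, hcell, hreach⟩ := exists_appetite_forall_reach_le.{u} hd
  refine ⟨α₀, hα₀, fun α hα Ω _ P _ Ξ hΞ => ?_⟩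
  obtain ⟨C, h⟩ := hreach Ω P Ξ hΞ
  filter_upwards [ae_forall_exists_reach_mem_box h] with ω hω ψ hψ hperc
  obtain ⟨z, hz⟩ := exists_reach_of_claimedPercolation hε (hcell α hα _ ψ hψ) hperc
  obtain ⟨r, hr⟩ := hω z
  obtain ⟨v, hv, hzv⟩ := hz r
  exact hv (hr v hzv)

theorem exists_forall_ae_unclaimedPercolation (hd : 2 ≤ d) :
    ∃ α₀ : ℝ≥0∞, 0 < α₀ ∧ ∀ α ≤ α₀,
      ∀ (Ω : Type u) [MeasurableSpace Ω] (P : Measure Ω) [IsProbabilityMeasure P]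
        (Ξ : Ω → Set (Site d)), IsPoissonProcess P Ξ 1 →
        ∀ᵐ ω ∂P, ∀ ψ, IsStableAllocation (Ξ ω) α ψ → UnclaimedPercolation ψ := by
  obtain ⟨α₀, hα₀, ε, hε, m, hcell, hreach⟩ :=
    exists_appetite_forall_reach_le.{u} (one_le_two.trans hd)
  refine ⟨α₀, hα₀, fun α hα Ω _ P _ Ξ hΞ => ?_⟩
  obtain ⟨C, h⟩ := hreach Ω P Ξ hΞ
  filter_upwards [ae_forall_exists_reach_mem_box h,
    ae_eventually_reach_mem_box h fun a => slice d (-(a : ℤ), 0)] with ω hω₁ hω₂ ψ hψ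
  exact unclaimedPercolation_of_reach hd hε (hcell α hα _ ψ hψ) hω₁ hω₂

theorem percolationThreshold_pos (hd : 1 ≤ d) : 0 < percolationThreshold d := by
  obtain ⟨α₀, hα₀, h⟩ := exists_forall_ae_not_claimedPercolation.{0} hd
  refine hα₀.trans_le (le_sSup fun Ω _ P _ Ξ hΞ => ?_)
  refine measure_mono_null ?_ (h α₀ le_rfl Ω P Ξ hΞ)
  rintro ω ⟨ψ, hψ, A, hA, -, hconn, hunb⟩ hω
  exact hω ψ hψ ⟨A, hA, hconn, hunb⟩

end StablePercolation

theorem theorem1 (d : ℕ) (hd : 2 ≤ d) :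
    (0 < percolationThreshold d ∧
      ∃ α₀ : ℝ≥0∞, 0 < α₀ ∧ ∀ α ≤ α₀,
        ∀ (Ω : Type u) [MeasurableSpace Ω] (P : Measure Ω) [IsProbabilityMeasure P]
          (Ξ : Ω → Set (Site d)), IsPoissonProcess P Ξ 1 →
          ∀ᵐ ω ∂P, ∀ ψ, IsStableAllocation (Ξ ω) α ψ → ¬ ClaimedPercolation ψ) ∧
    (∃ α₀ : ℝ≥0∞, 0 < α₀ ∧ ∀ α ≤ α₀,
        ∀ (Ω : Type u) [MeasurableSpace Ω] (P : Measure Ω) [IsProbabilityMeasure P]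
          (Ξ : Ω → Set (Site d)), IsPoissonProcess P Ξ 1 →
          ∀ᵐ ω ∂P, ∀ ψ, IsStableAllocation (Ξ ω) α ψ → UnclaimedPercolation ψ) :=
  ⟨⟨StablePercolation.percolationThreshold_pos (one_le_two.trans hd),
    StablePercolation.exists_forall_ae_not_claimedPercolation (one_le_two.trans hd)⟩,
    StablePercolation.exists_forall_ae_unclaimedPercolation hd⟩
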